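/- Let $\Bbbk$ be a field, let $x_1,\dots,x_n$ be indeterminates of degrees $|x_i|\in\mathbb Z$, and let $$R=\Bbbk\langle x_1,\dots,x_n\rangle/\langle x_ix_j-(-1)^{|x_i||x_j|}x_jx_i\mid 1\le i,j\le n\rangle$$ be the graded commutative polynomial algebra, equipped with an arbitrary structure of a differential graded Poisson algebra: a differential $d$ of degree $1$ with $d^2=0$ and a bracket $\{\cdot,\cdot\}$ of degree $0$ which is graded antisymmetric, satisfies the graded Jacobi identity, is a graded derivation of the product in the second argument, and satisfies $d\{a,b\}=\{da,b\}+(-1)^{|a|}\{a,db\}$. If $\operatorname{char}\Bbbk=2$, assume that $\{x_i,x_i\}=0$ for all $i$; if $\operatorname{char}\Bbbk=3$, assume that $\{x_i,\{x_i,x_i\}\}=0$ for all $i$ with $|x_i|$ odd (in characteristic other than $2,3$ nothing is assumed). For $1\le r\le n$ let $\psi_r:R\to R$ be the $\Bbbk$-linear map with $\psi_r(x_s)=\delta_{rs}$ and $\psi_r(ab)=a\psi_r(b)+(-1)^{|a||b|}b\psi_r(a)$ for homogeneous $a,b$. Let $F(R)=R\langle y_1,\dots,y_n\rangle$ be obtained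 from $R$ by freely adjoining noncommuting indeterminates $y_i$ (which do not commute with $R$ either) with $|y_i|=|x_i|$, put $\psi(f)=\sum_r\psi_r(f)y_r$, and let $R^e=F(R)/\mathfrak J$ be the universal enveloping algebra of $R$, where $\mathfrak J$ is the two-sided ideal generated by $$y_iy_j-(-1)^{|x_i||x_j|}y_jy_i-\psi(\{x_i,x_j\}),\qquad y_ix_j-(-1)^{|x_i||x_j|}x_jy_i-\{x_i,x_j\}\qquad(1\le i,j\le n).$$ Let $E$ be the set of all $J=(j_1,\dots,j_n)\in\mathbb N^n$ such that $j_r\le 1$ whenever $|x_r|$ is odd and $\operatorname{char}\Bbbk\ne 2$ (so $E=\mathbb N^n$ if all $|x_r|$ are even). Write $x^I=x_1^{i_1}\cdots x_n^{i_n}$ and $y^J=y_1^{j_1}\cdots y_n^{j_n}$. Then $R^e$ has a differential making it a DG algebra such that the canonical maps $R\to R^e$, $f\mapsto f$ and $f\mapsto\psi(f)$, commute with the differentials; thus $R^e$ is a left and a right DG $R$-module. As a graded left $R$-module and as a graded right $R$-module, $R^e$ is free with the homogeneous basis $\{y^J\mid J\in E\}$. Moreover, both $\{x^Iy^J\mid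 I,J\in E\}$ and the reversed monomials $\{y^Jx^I\mid I,J\in E\}$ are $\Bbbk$-bases of $R^e$. -/

import Mathlib

noncomputable section

namespace DGPoisson

open MulOpposite

/-! ### Differential graded algebras, DG Poisson algebras, DG modules -/

section General

variable {k : Type*} [Field k] {A : Type*} [Ring A] [Algebra k A]

/-- `d` is a differential making the `ℤ`-graded algebra `A` into a DG algebra. -/
structure IsDGAlgebra (𝒜 : ℤ → Submodule k A) [GradedAlgebra 𝒜] (d : A →ₗ[k] A) : Prop where
  map_mem : ∀ (p : ℤ), ∀ a ∈ 𝒜 p, d a ∈ 𝒜 (p + 1)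
  sq_zero : ∀ a, d (d a) = 0
  leibniz : ∀ (p : ℤ), ∀ a ∈ 𝒜 p, ∀ b, d (a * b) = d a * b + (-1 : k) ^ p • (a * d b)

/-- A DG Poisson algebra structure (differential and Poisson bracket of degree `0`) on the
`ℤ`-graded algebra `A`. -/
structure DGPoissonStructure (𝒜 : ℤ → Submodule k A) [GradedAlgebra 𝒜] where
  bracket : A →ₗ[k] A →ₗ[k] A
  d : A →ₗ[k] A
  isDGAlgebra : IsDGAlgebra 𝒜 d
  mul_comm : ∀ (p q : ℤ), ∀ a ∈ 𝒜 p, ∀ b ∈ 𝒜 q, a * b = (-1 : k) ^ (p * q) • (b * a)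
  bracket_mem : ∀ (p q : ℤ), ∀ a ∈ 𝒜 p, ∀ b ∈ 𝒜 q, bracket a b ∈ 𝒜 (p + q)
  antisymm : ∀ (p q : ℤ), ∀ a ∈ 𝒜 p, ∀ b ∈ 𝒜 q,
    bracket a b = -((-1 : k) ^ (p * q) • bracket b a)
  jacobi : ∀ (p q r : ℤ), ∀ a ∈ 𝒜 p, ∀ b ∈ 𝒜 q, ∀ c ∈ 𝒜 r,
    bracket a (bracket b c) =
      bracket (bracket a b) c + (-1 : k) ^ (p * q) • bracket b (bracket a c)
  bracket_mul : ∀ (p q r : ℤ), ∀ a ∈ 𝒜 p, ∀ b ∈ 𝒜 q, ∀ c ∈ 𝒜 r,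
    bracket a (b * c) = bracket a b * c + (-1 : k) ^ (p * q) • (b * bracket a c)
  d_bracket : ∀ (p q : ℤ), ∀ a ∈ 𝒜 p, ∀ b ∈ 𝒜 q,
    d (bracket a b) = bracket (d a) b + (-1 : k) ^ p • bracket a (d b)

variable {M : Type*} [AddCommGroup M] [Module k M]

/-- The graded left module `M` over the DG algebra `(A, d)` is, with `δ`, a left DG module. -/
structure IsLeftDGModule [Module A M] (𝒜 : ℤ → Submodule k A) (d : A →ₗ[k] A)
    (ℳ : ℤ → Submodule k M) (δ : M →ₗ[k] M) : Prop where
  isInternal : DirectSum.IsInternal ℳ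
  smul_mem : ∀ (p q : ℤ), ∀ a ∈ 𝒜 p, ∀ m ∈ ℳ q, a • m ∈ ℳ (p + q)
  map_mem : ∀ (p : ℤ), ∀ m ∈ ℳ p, δ m ∈ ℳ (p + 1)
  sq_zero : ∀ m, δ (δ m) = 0
  leibniz : ∀ (p : ℤ), ∀ a ∈ 𝒜 p, ∀ m, δ (a • m) = d a • m + (-1 : k) ^ p • (a • δ m)

/-- The graded right module `M` over the DG algebra `(A, d)` is, with `δ`, a right DG module
(`op a • m` is `m a`). -/
structure IsRightDGModule [Module Aᵐᵒᵖ M] (𝒜 : ℤ → Submodule k A) (d : A →ₗ[k] A)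
    (ℳ : ℤ → Submodule k M) (δ : M →ₗ[k] M) : Prop where
  isInternal : DirectSum.IsInternal ℳ
  smul_mem : ∀ (p q : ℤ), ∀ m ∈ ℳ p, ∀ a ∈ 𝒜 q, op a • m ∈ ℳ (p + q)
  map_mem : ∀ (p : ℤ), ∀ m ∈ ℳ p, δ m ∈ ℳ (p + 1)
  sq_zero : ∀ m, δ (δ m) = 0
  leibniz : ∀ (p : ℤ), ∀ m ∈ ℳ p, ∀ a,
    δ (op a • m) = op a • δ m + (-1 : k) ^ p • (op (d a) • m)

/-- The family `v` is a basis of the module `M` over the (not necessarily commutative) ring `S`. -/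
def IsBasis (S : Type*) [Ring S] {M : Type*} [AddCommGroup M] [Module S M] {ι : Type*}
    (v : ι → M) : Prop :=
  LinearIndependent S v ∧ Submodule.span S (Set.range v) = ⊤

/-- For elements `g i` of an algebra with weights `w i`, the span of all words of weight `m`. -/
def wordGrading (k : Type*) [Field k] {A : Type*} [Ring A] [Algebra k A] {ι : Type*}
    (g : ι → A) (w : ι → ℤ) (m : ℤ) : Submodule k A :=
  Submodule.span k {a | ∃ l : List ι, (l.map w).sum = m ∧ (l.map g).prod = a}

/-- The ordered monomial `g₁ ^ J₁ ⋯ gₙ ^ Jₙ`. -/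
def orderedMonomial {n : ℕ} (g : Fin n → A) (J : Fin n → ℕ) : A :=
  (List.ofFn fun r => g r ^ J r).prod

variable {ι : Type*} (g : ι → A) (w : ι → ℤ)

theorem gen_mem (i : ι) : g i ∈ wordGrading k g w (w i) :=
  Submodule.subset_span ⟨[i], by simp, by simp⟩

instance wordGrading_gradedMonoid : SetLike.GradedMonoid (wordGrading k g w) where
  one_mem := Submodule.subset_span ⟨[], by simp, by simp⟩
  mul_mem := by
    intro p q a b ha hb
    have h : a * b ∈ wordGrading k g w p * wordGrading k g w q := Submodule.mul_mem_mul ha hb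
    rw [wordGrading, wordGrading, Submodule.span_mul_span] at h
    refine Submodule.span_mono ?_ h
    rintro _ ⟨_, ⟨l, hl, rfl⟩, _, ⟨l', hl', rfl⟩, rfl⟩
    exact ⟨l ++ l', by simp [hl, hl'], by simp⟩

theorem hom_word_eq (θ : A →ₐ[k] DirectSum ℤ fun m => wordGrading k g w m)
    (hθ : ∀ i, θ (g i) = DirectSum.of (fun m => wordGrading k g w m) (w i) ⟨g i, gen_mem g w i⟩)
    (m : ℤ) (a : wordGrading k g w m) :
    θ a = DirectSum.of (fun m => wordGrading k g w m) m a := by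
  obtain ⟨a, ha⟩ := a
  have key : ∀ l : List ι, ∀ (h : (l.map g).prod ∈ wordGrading k g w (l.map w).sum),
      θ (l.map g).prod = DirectSum.of (fun m => wordGrading k g w m) (l.map w).sum ⟨_, h⟩ := by
    intro l
    induction l with
    | nil => intro h; simp; rfl
    | cons i l ih =>
      intro h
      have h' : (l.map g).prod ∈ wordGrading k g w (l.map w).sum :=
        Submodule.subset_span ⟨l, rfl, rfl⟩
      have e : θ (((i :: l).map g).prod) = θ (g i) * θ (l.map g).prod := by simp
      rw [e, hθ, ih h', DirectSum.of_mul_of]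
      exact DirectSum.of_eq_of_gradedMonoid_eq (Sigma.subtype_ext rfl rfl)
  induction ha using Submodule.span_induction with
  | mem x hx => obtain ⟨l, rfl, rfl⟩ := hx; exact key l _
  | zero => simp only [map_zero]; exact (map_zero _).symm
  | add x y hx hy ihx ihy => simp only [map_add, ihx, ihy]; exact (map_add _ _ _).symm
  | smul c x hx ih =>
    simp only [map_smul, ih]
    exact (map_smul (DirectSum.lof k ℤ (fun m => wordGrading k g w m) m) c ⟨x, hx⟩).symm

end General

/-! ### The graded commutative polynomial algebra -/

section Poly

variable (k : Type*) [Field k] {n : ℕ} (deg : Fin n → ℤ)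

/-- The relations `x_i x_j = (-1)^{|x_i||x_j|} x_j x_i` in the tensor (free) algebra. -/
inductive PolyRel : FreeAlgebra k (Fin n) → FreeAlgebra k (Fin n) → Prop
  | comm (i j : Fin n) : PolyRel (FreeAlgebra.ι k i * FreeAlgebra.ι k j)
      ((-1 : k) ^ (deg i * deg j) • (FreeAlgebra.ι k j * FreeAlgebra.ι k i))

/-- `R = T(V) / ⟨x_i ⊗ x_j - (-1)^{|x_i||x_j|} x_j ⊗ x_i⟩`, where `V` has the homogeneous basis
`x_1, …, x_n` with `|x_i| = deg i`. -/
def Poly : Type _ := RingQuot (PolyRel k deg)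

instance : Ring (Poly k deg) := inferInstanceAs (Ring (RingQuot (PolyRel k deg)))
instance : Algebra k (Poly k deg) := inferInstanceAs (Algebra k (RingQuot (PolyRel k deg)))

namespace Poly

/-- The projection `T(V) → R`. -/
def mk : FreeAlgebra k (Fin n) →ₐ[k] Poly k deg := RingQuot.mkAlgHom k (PolyRel k deg)

/-- The generator `x_i` of `R`. -/
def x (i : Fin n) : Poly k deg := mk k deg (FreeAlgebra.ι k i)

/-- `R_m`, the homogeneous elements of degree `m`. -/
abbrev grading : ℤ → Submodule k (Poly k deg) := wordGrading k (x k deg) deg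

variable {k deg}

theorem x_comm (i j : Fin n) :
    x k deg i * x k deg j = (-1 : k) ^ (deg i * deg j) • (x k deg j * x k deg i) := by
  have h : mk k deg _ = mk k deg _ :=
    RingQuot.mkAlgHom_rel k (PolyRel.comm (k := k) (deg := deg) i j)
  rwa [map_smul, map_mul, map_mul] at h

/-- The universal property of `R`. -/
def lift {B : Type*} [Ring B] [Algebra k B] (g : Fin n → B)
    (hg : ∀ i j, g i * g j = (-1 : k) ^ (deg i * deg j) • (g j * g i)) : Poly k deg →ₐ[k] B :=
  RingQuot.liftAlgHom k ⟨FreeAlgebra.lift k g, by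
    rintro _ _ ⟨i, j⟩
    simpa using hg i j⟩

@[simp] theorem lift_x {B : Type*} [Ring B] [Algebra k B] (g : Fin n → B)
    (hg : ∀ i j, g i * g j = (-1 : k) ^ (deg i * deg j) • (g j * g i)) (i : Fin n) :
    lift g hg (x k deg i) = g i :=
  (RingQuot.liftAlgHom_mkAlgHom_apply k _ _ _).trans (FreeAlgebra.lift_ι_apply _ _)

theorem hom_ext {B : Type*} [Ring B] [Algebra k B] {φ φ' : Poly k deg →ₐ[k] B}
    (h : ∀ i, φ (x k deg i) = φ' (x k deg i)) : φ = φ' := by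
  apply RingQuot.ringQuot_ext'
  apply FreeAlgebra.hom_ext
  funext i
  exact h i

/-- The decomposition of `R` into homogeneous components. -/
def decomposeHom : Poly k deg →ₐ[k] DirectSum ℤ fun m => grading k deg m :=
  lift (fun i => DirectSum.of (fun m => grading k deg m) (deg i) ⟨x k deg i, gen_mem _ _ i⟩)
    (by
      intro i j
      rw [DirectSum.of_mul_of, DirectSum.of_mul_of]
      change _ = (-1 : k) ^ (deg i * deg j) • DirectSum.lof k ℤ (fun m => grading k deg m) _ _
      rw [← map_smul]
      refine DirectSum.of_eq_of_gradedMonoid_eq (Sigma.subtype_ext (add_comm _ _) ?_)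
      exact x_comm i j)

instance : GradedAlgebra (grading k deg) :=
  GradedAlgebra.ofAlgHom (grading k deg) decomposeHom
    (hom_ext fun i => by simp [decomposeHom])
    (fun m a => hom_word_eq (x k deg) deg decomposeHom (fun i => lift_x _ _ i) m a)

theorem sign_mul_self (a : ℤ) : (-1 : k) ^ a * (-1 : k) ^ a = 1 := by
  rw [← mul_zpow]; simp

/-- The algebra map `a ↦ !![a, ψ_r(a); 0, (-1)^{|x_r||a|} a]` to `2 × 2` matrices. -/
def psiMatrix (r : Fin n) : Poly k deg →ₐ[k] Matrix (Fin 2) (Fin 2) (Poly k deg) :=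
  lift (fun s => !![x k deg s, if s = r then 1 else 0;
      0, (-1 : k) ^ (deg r * deg s) • x k deg s]) (by
    intro i j
    have e := x_comm (k := k) (deg := deg) i j
    have s1 := sign_mul_self (k := k) (deg i * deg j)
    simp only [Matrix.mul_fin_two, Matrix.smul_of, Matrix.smul_cons, Matrix.smul_empty]
    congr 1
    have h01 : x k deg i * (if j = r then 1 else 0) +
        (if i = r then 1 else 0) * ((-1 : k) ^ (deg r * deg j) • x k deg j) =
        (-1 : k) ^ (deg i * deg j) • (x k deg j * (if i = r then 1 else 0) +
        (if j = r then 1 else 0) * ((-1 : k) ^ (deg r * deg i) • x k deg i)) := by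
      by_cases hi : i = r <;> by_cases hj : j = r
      · subst hi; subst hj
        simp [smul_add, smul_smul, s1, add_comm]
      · subst hi
        simp [hj]
      · subst hj
        simp [hi, smul_smul, mul_comm (deg j) (deg i), s1]
      · simp [hi, hj]
    have h11 : ((-1 : k) ^ (deg r * deg i) • x k deg i) *
        ((-1 : k) ^ (deg r * deg j) • x k deg j) =
        (-1 : k) ^ (deg i * deg j) • (((-1 : k) ^ (deg r * deg j) • x k deg j) *
        ((-1 : k) ^ (deg r * deg i) • x k deg i)) := by
      simp only [smul_mul_smul_comm, e, smul_smul]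
      congr 1
      ring
    rw [h01, h11]
    simp [e])

/-- The anti-differential `ψ_r : R → R`. -/
def psi (r : Fin n) : Poly k deg →ₗ[k] Poly k deg where
  toFun a := psiMatrix r a 0 1
  map_add' := by simp
  map_smul' := by simp

/-- `ψ_r(x_s) = δ_{rs}`. -/
theorem psi_x (r s : Fin n) : psi r (x k deg s) = if s = r then 1 else 0 := by
  simp [psi, psiMatrix]

theorem psiMatrix_apply (r : Fin n) (l : List (Fin n)) :
    psiMatrix r (l.map (x k deg)).prod 0 0 = (l.map (x k deg)).prod ∧
    psiMatrix r (l.map (x k deg)).prod 1 0 = 0 ∧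
    psiMatrix r (l.map (x k deg)).prod 1 1 =
      (-1 : k) ^ (deg r * (l.map deg).sum) • (l.map (x k deg)).prod ∧
    psiMatrix r (l.map (x k deg)).prod 0 1 ∈ grading k deg ((l.map deg).sum - deg r) := by
  induction l with
  | nil => simp
  | cons s l ih =>
    obtain ⟨h00, h10, h11, h01⟩ := ih
    simp only [List.map_cons, List.prod_cons, map_mul, List.sum_cons, Matrix.mul_apply,
      Fin.sum_univ_two, h00, h10, h11]
    have hx : psiMatrix r (x k deg s) = _ := lift_x _ _ s
    rw [hx]
    refine ⟨by simp, by simp, ?_, ?_⟩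
    · simp [smul_smul, mul_add, zpow_add₀, mul_comm]
    · simp only [Matrix.of_apply, Matrix.cons_val', Matrix.cons_val_zero, Matrix.cons_val_one,
        Matrix.cons_val_fin_one]
      refine Submodule.add_mem _ ?_ ?_
      · rw [add_sub_assoc]
        exact SetLike.mul_mem_graded (gen_mem (k := k) (x k deg) deg s) h01
      · split_ifs with h
        · subst h
          simp only [one_mul, add_sub_cancel_left]
          exact Submodule.smul_mem _ _ (Submodule.subset_span ⟨l, rfl, rfl⟩)
        · simp

theorem psiMatrix_of_mem (r : Fin n) {p : ℤ} {a : Poly k deg} (ha : a ∈ grading k deg p) :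
    psiMatrix r a 0 0 = a ∧ psiMatrix r a 1 1 = (-1 : k) ^ (deg r * p) • a ∧
      psi r a ∈ grading k deg (p - deg r) := by
  change _ ∧ _ ∧ psiMatrix r a 0 1 ∈ _
  induction ha using Submodule.span_induction with
  | mem a h =>
    obtain ⟨l, rfl, rfl⟩ := h
    obtain ⟨h00, -, h11, h01⟩ := psiMatrix_apply (k := k) (deg := deg) r l
    exact ⟨h00, h11, h01⟩
  | zero => simp
  | add a b _ _ iha ihb =>
    simp only [map_add, Matrix.add_apply, iha.1, ihb.1, iha.2.1, ihb.2.1, smul_add, true_and]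
    exact Submodule.add_mem _ iha.2.2 ihb.2.2
  | smul c a _ iha =>
    simp only [map_smul, Matrix.smul_apply, iha.1, iha.2.1, true_and]
    exact ⟨smul_comm _ _ _, Submodule.smul_mem _ _ iha.2.2⟩

theorem word_comm (i : Fin n) (l : List (Fin n)) :
    x k deg i * (l.map (x k deg)).prod =
      (-1 : k) ^ (deg i * (l.map deg).sum) • ((l.map (x k deg)).prod * x k deg i) := by
  induction l with
  | nil => simp
  | cons j l ih =>
    rw [List.map_cons, List.map_cons, List.prod_cons, List.sum_cons, ← mul_assoc, x_comm,
      smul_mul_assoc, mul_assoc, ih, mul_smul_comm, smul_smul, mul_add,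
      zpow_add₀ (by simp : (-1 : k) ≠ 0), mul_assoc]

/-- `R` is graded commutative. -/
theorem graded_comm {p q : ℤ} {a b : Poly k deg} (ha : a ∈ grading k deg p)
    (hb : b ∈ grading k deg q) : a * b = (-1 : k) ^ (p * q) • (b * a) := by
  induction ha using Submodule.span_induction with
  | mem a h =>
    obtain ⟨l, rfl, rfl⟩ := h
    induction hb using Submodule.span_induction with
    | mem b h =>
      obtain ⟨l', rfl, rfl⟩ := h
      induction l with
      | nil => simp
      | cons i l ih =>
        rw [List.map_cons, List.map_cons, List.prod_cons, List.sum_cons, mul_assoc, ih,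
          mul_smul_comm, ← mul_assoc, word_comm, smul_mul_assoc, smul_smul, add_mul,
          zpow_add₀ (by simp : (-1 : k) ≠ 0), mul_assoc, mul_comm ((-1 : k) ^ _)]
    | zero => simp
    | add b c _ _ ihb ihc => rw [mul_add, add_mul, smul_add, ihb, ihc]
    | smul c b _ ihb => rw [mul_smul_comm, smul_mul_assoc, ihb, smul_comm]
  | zero => simp
  | add a c _ _ iha ihc => rw [mul_add, add_mul, smul_add, iha, ihc]
  | smul c a _ iha => rw [mul_smul_comm, smul_mul_assoc, iha, smul_comm]

/-- `ψ_r(ab) = a ψ_r(b) + (-1)^{|a||b|} b ψ_r(a)`. -/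
theorem psi_mul (r : Fin n) {p q : ℤ} {a b : Poly k deg} (ha : a ∈ grading k deg p)
    (hb : b ∈ grading k deg q) :
    psi r (a * b) = a * psi r b + (-1 : k) ^ (p * q) • (b * psi r a) := by
  obtain ⟨h00, -, hψ⟩ := psiMatrix_of_mem r ha
  obtain ⟨-, h11, -⟩ := psiMatrix_of_mem r hb
  have h : psi r (a * b) = psiMatrix r a 0 0 * psi r b + psi r a * psiMatrix r b 1 1 := by
    change psiMatrix r (a * b) 0 1 = _
    rw [map_mul, Matrix.mul_apply, Fin.sum_univ_two]
    rfl
  rw [h, h00, h11, graded_comm hb hψ, mul_smul_comm, smul_smul]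
  congr 2
  have e : p * q + q * (p - deg r) = (q * (p - deg r) + q * (p - deg r)) + deg r * q := by ring
  rw [← zpow_add₀ (by simp : (-1 : k) ≠ 0), e, zpow_add₀ (by simp : (-1 : k) ≠ 0),
    zpow_add₀ (by simp : (-1 : k) ≠ 0), sign_mul_self, one_mul]

end Poly

end Poly

/-! ### The free extension `F(R) = R⟨y_1, …, y_n⟩` -/

section FreeExt

variable (k : Type*) [Field k] {n : ℕ} (deg : Fin n → ℤ)

/-- Among the free generators `x_i = inl i`, `y_i = inr i`, only the defining relations of `R` are
imposed on the `x_i`. -/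
inductive FreeExtRel : FreeAlgebra k (Fin n ⊕ Fin n) → FreeAlgebra k (Fin n ⊕ Fin n) → Prop
  | comm (i j : Fin n) : FreeExtRel
      (FreeAlgebra.ι k (Sum.inl i) * FreeAlgebra.ι k (Sum.inl j))
      ((-1 : k) ^ (deg i * deg j) •
        (FreeAlgebra.ι k (Sum.inl j) * FreeAlgebra.ι k (Sum.inl i)))

/-- `F(R) = R⟨y_1, …, y_n⟩`, the algebra obtained from `R` by freely adjoining noncommuting
indeterminates `y_i`, which do not commute with `R` either. -/
def FreeExt : Type _ := RingQuot (FreeExtRel k deg)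

instance : Ring (FreeExt k deg) := inferInstanceAs (Ring (RingQuot (FreeExtRel k deg)))
instance : Algebra k (FreeExt k deg) :=
  inferInstanceAs (Algebra k (RingQuot (FreeExtRel k deg)))

namespace FreeExt

/-- The projection from the free algebra on the `x_i` and `y_i`. -/
def mk : FreeAlgebra k (Fin n ⊕ Fin n) →ₐ[k] FreeExt k deg :=
  RingQuot.mkAlgHom k (FreeExtRel k deg)

/-- The generator `x_i` of `F(R)`. -/
def x (i : Fin n) : FreeExt k deg := mk k deg (FreeAlgebra.ι k (Sum.inl i))

/-- The generator `y_i` of `F(R)`. -/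
def y (i : Fin n) : FreeExt k deg := mk k deg (FreeAlgebra.ι k (Sum.inr i))

variable {k deg}

theorem x_comm (i j : Fin n) :
    x k deg i * x k deg j = (-1 : k) ^ (deg i * deg j) • (x k deg j * x k deg i) := by
  have h : mk k deg _ = mk k deg _ :=
    RingQuot.mkAlgHom_rel k (FreeExtRel.comm (k := k) (deg := deg) i j)
  rwa [map_smul, map_mul, map_mul] at h

/-- The canonical map `R → F(R)`. -/
def incl : Poly k deg →ₐ[k] FreeExt k deg := Poly.lift (x k deg) x_comm

/-- `ψ : R → F(R)`, `ψ(f) = ∑_r ψ_r(f) y_r`. -/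
def psi : Poly k deg →ₗ[k] FreeExt k deg :=
  ∑ r, LinearMap.mulRight k (y k deg r) ∘ₗ incl.toLinearMap ∘ₗ Poly.psi r

theorem psi_apply (f : Poly k deg) : psi f = ∑ r, incl (Poly.psi r f) * y k deg r := by
  simp [psi]

/-- The universal property of `F(R)`. -/
def lift {B : Type*} [Ring B] [Algebra k B] (g h : Fin n → B)
    (hg : ∀ i j, g i * g j = (-1 : k) ^ (deg i * deg j) • (g j * g i)) : FreeExt k deg →ₐ[k] B :=
  RingQuot.liftAlgHom k ⟨FreeAlgebra.lift k (Sum.elim g h), by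
    rintro _ _ ⟨i, j⟩
    simpa using hg i j⟩

@[simp] theorem lift_x {B : Type*} [Ring B] [Algebra k B] (g h : Fin n → B)
    (hg : ∀ i j, g i * g j = (-1 : k) ^ (deg i * deg j) • (g j * g i)) (i : Fin n) :
    lift g h hg (x k deg i) = g i :=
  (RingQuot.liftAlgHom_mkAlgHom_apply k _ _ _).trans (FreeAlgebra.lift_ι_apply _ _)

@[simp] theorem lift_y {B : Type*} [Ring B] [Algebra k B] (g h : Fin n → B)
    (hg : ∀ i j, g i * g j = (-1 : k) ^ (deg i * deg j) • (g j * g i)) (i : Fin n) :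
    lift g h hg (y k deg i) = h i :=
  (RingQuot.liftAlgHom_mkAlgHom_apply k _ _ _).trans (FreeAlgebra.lift_ι_apply _ _)

theorem hom_ext {B : Type*} [Ring B] [Algebra k B] {φ φ' : FreeExt k deg →ₐ[k] B}
    (hx : ∀ i, φ (x k deg i) = φ' (x k deg i)) (hy : ∀ i, φ (y k deg i) = φ' (y k deg i)) :
    φ = φ' := by
  apply RingQuot.ringQuot_ext'
  apply FreeAlgebra.hom_ext
  funext i
  cases i with
  | inl i => exact hx i
  | inr i => exact hy i

end FreeExt

end FreeExt

/-! ### The universal enveloping algebra `R^e = F(R) / J` -/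

section Env

variable {k : Type*} [Field k] {n : ℕ} {deg : Fin n → ℤ}

/-- The relations generating the ideal `J` of `F(R)`. -/
inductive EnvRel (P : DGPoissonStructure (Poly.grading k deg)) :
    FreeExt k deg → FreeExt k deg → Prop
  | yy (i j : Fin n) : EnvRel P
      (FreeExt.y k deg i * FreeExt.y k deg j -
        (-1 : k) ^ (deg i * deg j) • (FreeExt.y k deg j * FreeExt.y k deg i) -
        FreeExt.psi (P.bracket (Poly.x k deg i) (Poly.x k deg j))) 0
  | yx (i j : Fin n) : EnvRel P
      (FreeExt.y k deg i * FreeExt.x k deg j -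
        (-1 : k) ^ (deg i * deg j) • (FreeExt.x k deg j * FreeExt.y k deg i) -
        FreeExt.incl (P.bracket (Poly.x k deg i) (Poly.x k deg j))) 0

variable (P : DGPoissonStructure (Poly.grading k deg))

/-- The universal enveloping algebra `R^e` of the DG Poisson algebra `R`. -/
def Env : Type _ := RingQuot (EnvRel P)

instance : Ring (Env P) := inferInstanceAs (Ring (RingQuot (EnvRel P)))
instance : Algebra k (Env P) := inferInstanceAs (Algebra k (RingQuot (EnvRel P)))

namespace Env

/-- The canonical projection `π : F(R) → R^e`. -/
def mk : FreeExt k deg →ₐ[k] Env P := RingQuot.mkAlgHom k (EnvRel P)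

/-- The canonical algebra map `R → R^e`. -/
def m : Poly k deg →ₐ[k] Env P := (mk P).comp FreeExt.incl

/-- The canonical linear map `h : R → R^e`, `h(f) = ∑_r ψ_r(f) y_r`. -/
def h : Poly k deg →ₗ[k] Env P := (mk P).toLinearMap ∘ₗ FreeExt.psi

/-- The image of `x_i` in `R^e`. -/
def x (i : Fin n) : Env P := m P (Poly.x k deg i)

/-- The image of `y_i` in `R^e`. -/
def y (i : Fin n) : Env P := mk P (FreeExt.y k deg i)

/-- `R^e` as a left `R`-module: `f • u = f u`. -/
instance : Module (Poly k deg) (Env P) := Module.compHom (Env P) (m P).toRingHom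

/-- `R^e` as a right `R`-module: `op f • u = u f`. -/
instance : Module (Poly k deg)ᵐᵒᵖ (Env P) := Module.compHom (Env P) (m P).toRingHom.op

theorem smul_def (f : Poly k deg) (u : Env P) : f • u = m P f * u := rfl

theorem op_smul_def (f : Poly k deg) (u : Env P) : op f • u = u * m P f := rfl

/-- The homogeneous elements of degree `p` of `R^e`, where `|x_i| = |y_i| = deg i`. -/
abbrev grading : ℤ → Submodule k (Env P) :=
  wordGrading k (Sum.elim (x P) (y P)) (Sum.elim deg deg)

variable {P}

theorem mk_x (i : Fin n) : mk P (FreeExt.x k deg i) = x P i := by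
  simp [x, m, FreeExt.incl]

theorem y_mul_y (i j : Fin n) : y P i * y P j =
    (-1 : k) ^ (deg i * deg j) • (y P j * y P i) +
      h P (P.bracket (Poly.x k deg i) (Poly.x k deg j)) := by
  have e : mk P _ = mk P 0 := RingQuot.mkAlgHom_rel k (EnvRel.yy (P := P) i j)
  rw [map_sub, map_sub, map_smul, map_mul, map_mul, map_zero, sub_sub, sub_eq_zero] at e
  exact e

theorem y_mul_x (i j : Fin n) : y P i * x P j =
    (-1 : k) ^ (deg i * deg j) • (x P j * y P i) +
      m P (P.bracket (Poly.x k deg i) (Poly.x k deg j)) := by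
  have e : mk P _ = mk P 0 := RingQuot.mkAlgHom_rel k (EnvRel.yx (P := P) i j)
  rw [map_sub, map_sub, map_smul, map_mul, map_mul, map_zero, sub_sub, sub_eq_zero, mk_x] at e
  exact e

theorem x_comm (i j : Fin n) : x P i * x P j = (-1 : k) ^ (deg i * deg j) • (x P j * x P i) := by
  simp only [x, ← map_mul, ← map_smul, Poly.x_comm i j]

theorem x_mem (i : Fin n) : x P i ∈ grading P (deg i) :=
  gen_mem (k := k) (Sum.elim (x P) (y P)) (Sum.elim deg deg) (Sum.inl i)

theorem y_mem (i : Fin n) : y P i ∈ grading P (deg i) :=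
  gen_mem (k := k) (Sum.elim (x P) (y P)) (Sum.elim deg deg) (Sum.inr i)

theorem m_mem {p : ℤ} {f : Poly k deg} (hf : f ∈ Poly.grading k deg p) :
    m P f ∈ grading P p := by
  induction hf using Submodule.span_induction with
  | mem a ha =>
    obtain ⟨l, rfl, rfl⟩ := ha
    refine Submodule.subset_span ⟨l.map Sum.inl, ?_, ?_⟩
    · rw [List.map_map]; rfl
    · rw [List.map_map, map_list_prod, List.map_map]; rfl
  | zero => simp
  | add a b _ _ iha ihb => rw [map_add]; exact Submodule.add_mem _ iha ihb
  | smul c a _ iha => rw [map_smul]; exact Submodule.smul_mem _ _ iha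

/-- The map from `F(R)` to the direct sum of the homogeneous parts of `R^e`. -/
def preDecompose (P : DGPoissonStructure (Poly.grading k deg)) :
    FreeExt k deg →ₐ[k] DirectSum ℤ fun p => grading P p :=
  FreeExt.lift
    (fun i => DirectSum.of (fun p => grading P p) (deg i) ⟨x P i, x_mem i⟩)
    (fun i => DirectSum.of (fun p => grading P p) (deg i) ⟨y P i, y_mem i⟩)
    (by
      intro i j
      rw [DirectSum.of_mul_of, DirectSum.of_mul_of]
      change _ = (-1 : k) ^ (deg i * deg j) • DirectSum.lof k ℤ (fun p => grading P p) _ _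
      rw [← map_smul]
      refine DirectSum.of_eq_of_gradedMonoid_eq (Sigma.subtype_ext (add_comm _ _) ?_)
      exact x_comm i j)

theorem coe_preDecompose (z : FreeExt k deg) :
    DirectSum.coeAlgHom (grading P) (preDecompose P z) = mk P z := by
  have h : (DirectSum.coeAlgHom (grading P)).comp (preDecompose P) = mk P :=
    FreeExt.hom_ext (fun i => by simp [preDecompose, mk_x])
      (fun i => by simp [preDecompose]; rfl)
  exact DFunLike.congr_fun h z

/-- The elements of the direct sum that are concentrated in degree `p`. -/
abbrev conc (P : DGPoissonStructure (Poly.grading k deg)) (p : ℤ) :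
    Submodule k (DirectSum ℤ fun p => grading P p) :=
  LinearMap.range (DirectSum.lof k ℤ (fun p => grading P p) p)

theorem conc_mul {p q : ℤ} {a b : DirectSum ℤ fun p => grading P p} (ha : a ∈ conc P p)
    (hb : b ∈ conc P q) : a * b ∈ conc P (p + q) := by
  obtain ⟨u, rfl⟩ := ha
  obtain ⟨v, rfl⟩ := hb
  exact ⟨_, (DirectSum.of_mul_of (A := fun p => grading P p) u v).symm⟩

theorem preDecompose_x (i : Fin n) : preDecompose P (FreeExt.x k deg i) ∈ conc P (deg i) :=
  ⟨⟨x P i, x_mem i⟩, by rw [preDecompose, FreeExt.lift_x]; rfl⟩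

theorem preDecompose_y (i : Fin n) : preDecompose P (FreeExt.y k deg i) ∈ conc P (deg i) :=
  ⟨⟨y P i, y_mem i⟩, by rw [preDecompose, FreeExt.lift_y]; rfl⟩

theorem preDecompose_incl {p : ℤ} {f : Poly k deg} (hf : f ∈ Poly.grading k deg p) :
    preDecompose P (FreeExt.incl f) ∈ conc P p := by
  induction hf using Submodule.span_induction with
  | mem a ha =>
    obtain ⟨l, rfl, rfl⟩ := ha
    induction l with
    | nil => simp only [List.map_nil, List.prod_nil, List.sum_nil, map_one]; exact ⟨_, rfl⟩
    | cons i l ih =>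
      simp only [List.map_cons, List.prod_cons, List.sum_cons, map_mul]
      refine conc_mul ?_ ih
      rw [FreeExt.incl, Poly.lift_x]
      exact preDecompose_x i
  | zero => simp only [map_zero]; exact Submodule.zero_mem _
  | add a b _ _ iha ihb => simp only [map_add]; exact Submodule.add_mem _ iha ihb
  | smul c a _ iha => simp only [map_smul]; exact Submodule.smul_mem _ _ iha

theorem preDecompose_psi {p : ℤ} {f : Poly k deg} (hf : f ∈ Poly.grading k deg p) :
    preDecompose P (FreeExt.psi f) ∈ conc P p := by
  rw [FreeExt.psi_apply, map_sum]
  refine Submodule.sum_mem _ fun r _ => ?_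
  rw [map_mul]
  have h := conc_mul (preDecompose_incl (P := P) (Poly.psiMatrix_of_mem r hf).2.2)
    (preDecompose_y r)
  rwa [sub_add_cancel] at h

theorem eq_zero_of_conc {p : ℤ} {z : FreeExt k deg} (hz : preDecompose P z ∈ conc P p)
    (h0 : mk P z = 0) : preDecompose P z = 0 := by
  obtain ⟨u, hu⟩ := hz
  rw [← coe_preDecompose, ← hu, DirectSum.lof_eq_of, DirectSum.coeAlgHom_of] at h0
  rw [← hu, (Subtype.ext h0 : u = 0), map_zero]

theorem conc_sub {p q : ℤ} {c : k} {a b z : FreeExt k deg} (ha : preDecompose P a ∈ conc P p)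
    (hb : preDecompose P b ∈ conc P q) (hz : preDecompose P z ∈ conc P (p + q)) :
    preDecompose P (a * b - c • (b * a) - z) ∈ conc P (p + q) := by
  have h1 := conc_mul ha hb
  have h2 := conc_mul hb ha
  rw [add_comm q p] at h2
  have e : a * b - c • (b * a) - z = a * b + (-c) • (b * a) + (-1 : k) • z := by
    rw [neg_smul, neg_smul, one_smul]; abel
  rw [e, map_add, map_add, map_smul, map_smul, map_mul, map_mul]
  exact Submodule.add_mem _ (Submodule.add_mem _ h1 (Submodule.smul_mem _ _ h2))
    (Submodule.smul_mem _ _ hz)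

theorem preDecompose_rel {a b : FreeExt k deg} (hab : EnvRel P a b) :
    preDecompose P a = preDecompose P b := by
  have h0 : mk P a = mk P b := RingQuot.mkAlgHom_rel k hab
  have hx (i : Fin n) := gen_mem (k := k) (Poly.x k deg) deg i
  cases hab with
  | yy i j =>
    rw [map_zero] at h0 ⊢
    exact eq_zero_of_conc (conc_sub (preDecompose_y i) (preDecompose_y j)
      (preDecompose_psi (P.bracket_mem _ _ _ (hx i) _ (hx j)))) h0
  | yx i j =>
    rw [map_zero] at h0 ⊢
    exact eq_zero_of_conc (conc_sub (preDecompose_y i) (preDecompose_x j)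
      (preDecompose_incl (P.bracket_mem _ _ _ (hx i) _ (hx j)))) h0

/-- The decomposition of `R^e` into homogeneous components. -/
def decomposeHom (P : DGPoissonStructure (Poly.grading k deg)) :
    Env P →ₐ[k] DirectSum ℤ fun p => grading P p :=
  RingQuot.liftAlgHom k ⟨preDecompose P, fun _ _ hab => preDecompose_rel hab⟩

theorem decomposeHom_mk (z : FreeExt k deg) : decomposeHom P (mk P z) = preDecompose P z :=
  RingQuot.liftAlgHom_mkAlgHom_apply k _ _ _

theorem hom_ext {B : Type*} [Ring B] [Algebra k B] {φ φ' : Env P →ₐ[k] B}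
    (h : ∀ z, φ (mk P z) = φ' (mk P z)) : φ = φ' := by
  apply RingQuot.ringQuot_ext'
  exact AlgHom.ext h

/-- `R^e` is a graded algebra. -/
instance : GradedAlgebra (grading P) :=
  GradedAlgebra.ofAlgHom (grading P) (decomposeHom P)
    (hom_ext fun z => by
      rw [AlgHom.comp_apply, decomposeHom_mk, coe_preDecompose, AlgHom.id_apply])
    (fun p a => hom_word_eq (Sum.elim (x P) (y P)) (Sum.elim deg deg) (decomposeHom P)
      (fun i => by
        cases i with
        | inl i =>
          change decomposeHom P (x P i) = _
          rw [← mk_x, decomposeHom_mk, preDecompose, FreeExt.lift_x]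
          rfl
        | inr i =>
          change decomposeHom P (mk P (FreeExt.y k deg i)) = _
          rw [decomposeHom_mk, preDecompose, FreeExt.lift_y]
          rfl) p a)

end Env

/-- The exponents of the monomials: `J_r ∈ ℕ`, with `J_r ≤ 1` where `|x_r|` is odd and `2 ≠ 0` in
`k` (so that `x_r ^ 2 = 0` in `R`). -/
def Exponent (k : Type*) [Field k] {n : ℕ} (deg : Fin n → ℤ) : Type :=
  {J : Fin n → ℕ // ∀ r, Odd (deg r) → (2 : k) ≠ 0 → J r ≤ 1}

end Env

end DGPoisson

/-! The differential: a map `δ` of degree 1 is a graded derivation when `a ↦ !![(-1)^{|a|} a, δ a;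
0, a]` is multiplicative. So `δ x_i = m (d x_i)`, `δ y_i = h (d x_i)` defines `δ` once these
matrices satisfy the relations of `R^e`. This needs the commutation rules of `m a` and `h b` for all
homogeneous elements (`h_mul_m`, `h_mul_h`) and the compatibility of `d` with the bracket. The rules
follow from those for generators because the defect `curvature` is tensorial.

The left basis is a Poincaré–Birkhoff–Witt theorem. That the ordered monomials span is rewriting;
independence comes from a representation of `R^e` on the free `R`-module on standard words, in which
the monomial of `w` sends the empty word to `w`. The operators `yAct` are forced by the relations: a
letter that fits is prepended, a descent is exchanged up to a bracket, and a repeated fermionic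
letter is replaced by half of the bracket. The relations between `y_i` and `R` hold by construction.
Those between `y_i` and `y_j` hold by construction where one of the two letters can be prepended,
and otherwise by induction on length from the Jacobi identity (`isFlat_mono`). The self-brackets
meet the assumptions in characteristics 2 and 3: `{x_i,x_i} = 0` for non-fermionic `x_i`, and
`{x_i,{x_i,x_i}} = 0` for fermionic ones. The action on the empty word and the evaluation `ofStd`
are then mutually inverse.

The right basis follows by triangularity: moving `f` across a monomial twists it by a sign
automorphism and adds shorter words (`actEnv_eval_smul_sub_mem`). The `k`-bases follow from a
`k`-basis of `R`, itself obtained from the left basis theorem for the zero bracket, where the `y_i`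
generate a copy of `R`. -/

namespace DGPoisson

/-! ### Signs, homogeneous elements and twists of `R` -/

section Homogeneous

variable {k : Type*} [Field k] {n : ℕ} {deg : Fin n → ℤ}

/-- The long sign identities below are settled by splitting every sign into its two values, after
which `abel` suffices. -/
theorem neg_one_zpow_cases (p : ℤ) : (-1 : k) ^ p = 1 ∨ (-1 : k) ^ p = -1 := by
  rcases Int.even_or_odd p with h | h
  · exact Or.inl h.neg_one_zpow
  · exact Or.inr h.neg_one_zpow

theorem neg_one_zpow_add (p q : ℤ) : (-1 : k) ^ (p + q) = (-1) ^ p * (-1) ^ q :=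
  zpow_add₀ (by simp) _ _

namespace Poly

theorem x_mem (i : Fin n) : x k deg i ∈ grading k deg (deg i) := gen_mem _ _ i

/-- To prove a linear property of homogeneous elements of `R`, it suffices to treat `1` and
products with a generator. -/
theorem homogeneous_induction {Q : ∀ (p : ℤ) (a : Poly k deg), a ∈ grading k deg p → Prop}
    (one : Q 0 1 SetLike.GradedOne.one_mem)
    (x_mul : ∀ i p a (ha : a ∈ grading k deg p), Q p a ha →
      Q (deg i + p) (x k deg i * a) (SetLike.mul_mem_graded (x_mem i) ha))
    (zero : ∀ p, Q p 0 (Submodule.zero_mem _))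
    (add : ∀ p a b (ha : a ∈ grading k deg p) (hb : b ∈ grading k deg p), Q p a ha → Q p b hb →
      Q p (a + b) (Submodule.add_mem _ ha hb))
    (smul : ∀ p (c : k) a (ha : a ∈ grading k deg p), Q p a ha →
      Q p (c • a) (Submodule.smul_mem _ c ha))
    {p : ℤ} {a : Poly k deg} (ha : a ∈ grading k deg p) : Q p a ha := by
  induction ha using Submodule.span_induction with
  | mem a h =>
    obtain ⟨l, rfl, rfl⟩ := h
    induction l with
    | nil => exact one
    | cons i l ih => exact x_mul i _ _ _ ih
  | zero => exact zero p
  | add a b ha hb iha ihb => exact add p a b ha hb iha ihb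
  | smul c a ha iha => exact smul p c a ha iha

/-- Two linear maps on `R` agree if they agree on homogeneous elements. -/
theorem linearMap_ext {V : Type*} [AddCommGroup V] [Module k V] {φ φ' : Poly k deg →ₗ[k] V}
    (h : ∀ p, ∀ a ∈ grading k deg p, φ a = φ' a) : φ = φ' := by
  ext a
  induction a using DirectSum.Decomposition.inductionOn (grading k deg) with
  | zero => simp
  | homogeneous a => exact h _ a a.2
  | add a b iha ihb => rw [map_add, map_add, iha, ihb]

/-- The automorphism `a ↦ (-1)^{|x_i||a|} a`. -/
def twist (i : Fin n) : Poly k deg →ₐ[k] Poly k deg :=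
  lift (fun s => (-1 : k) ^ (deg i * deg s) • x k deg s) fun r s => by
    rw [smul_mul_smul_comm, smul_mul_smul_comm, x_comm r s, smul_smul, smul_smul]
    congr 1
    ring

/-- Being an algebra map on all of `R`, the twist carries the Koszul sign into formulas without
homogeneity assumptions. -/
theorem twist_of_mem (i : Fin n) {p : ℤ} {a : Poly k deg} (ha : a ∈ grading k deg p) :
    twist i a = (-1 : k) ^ (deg i * p) • a := by
  induction ha using homogeneous_induction with
  | one => simp
  | x_mul j p a ha ih =>
    rw [map_mul, ih, twist, lift_x, smul_mul_smul_comm, mul_add, neg_one_zpow_add]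
  | zero => simp
  | add p a b ha hb iha ihb => rw [map_add, iha, ihb, smul_add]
  | smul p c a ha ih => rw [map_smul, ih, smul_comm]

theorem twist_twist (i : Fin n) (a : Poly k deg) : twist i (twist i a) = a := by
  have : (twist i).comp (twist i) = AlgHom.id k (Poly k deg) := hom_ext fun s => by
    simp [twist, smul_smul, sign_mul_self]
  exact DFunLike.congr_fun this a

theorem psi_one (r : Fin n) : psi r (1 : Poly k deg) = 0 := by
  simp [psi]

end Poly

end Homogeneous

/-! ### Elementary consequences of the Poisson axioms -/

section Bracket

variable {k : Type*} [Field k] {n : ℕ} {deg : Fin n → ℤ}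
  (P : DGPoissonStructure (Poly.grading k deg))

namespace DGPoissonStructure

/-- The Leibniz rule for `1 = 1 * 1` gives `{a,1} = {a,1} + {a,1}`. -/
theorem bracket_one {p : ℤ} {a : Poly k deg} (ha : a ∈ Poly.grading k deg p) :
    P.bracket a 1 = 0 := by
  have h := P.bracket_mul p 0 0 a ha 1 SetLike.GradedOne.one_mem 1 SetLike.GradedOne.one_mem
  simpa using h

theorem d_one : P.d 1 = 0 := by
  have h := P.isDGAlgebra.leibniz 0 1 SetLike.GradedOne.one_mem 1
  simpa using h

/-- Antisymmetry carries the Leibniz rule over to the first argument. -/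
theorem mul_bracket {p q r : ℤ} {a b c : Poly k deg} (ha : a ∈ Poly.grading k deg p)
    (hb : b ∈ Poly.grading k deg q) (hc : c ∈ Poly.grading k deg r) :
    P.bracket (a * b) c = a * P.bracket b c + (-1 : k) ^ (p * q) • (b * P.bracket a c) := by
  rw [P.antisymm (p + q) r _ (SetLike.mul_mem_graded ha hb) c hc,
    P.bracket_mul r p q c hc a ha b hb, P.antisymm q r b hb c hc, P.antisymm p r a ha c hc,
    Poly.graded_comm (P.bracket_mem r p c hc a ha) hb]
  simp only [mul_neg, mul_smul_comm, smul_add, smul_neg, smul_smul, add_mul, neg_one_zpow_add,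
    _root_.mul_comm r p, _root_.mul_comm r q]
  rcases neg_one_zpow_cases (k := k) (p * q) with h1 | h1 <;>
  rcases neg_one_zpow_cases (k := k) (p * r) with h2 | h2 <;>
  rcases neg_one_zpow_cases (k := k) (q * r) with h3 | h3 <;>
  simp [h1, h2, h3, add_comm]

theorem bracket_x_mul (i : Fin n) (a b : Poly k deg) :
    P.bracket (Poly.x k deg i) (a * b) =
      P.bracket (Poly.x k deg i) a * b + Poly.twist i a * P.bracket (Poly.x k deg i) b := by
  have h : (LinearMap.mul k (Poly k deg)).compr₂ (P.bracket (Poly.x k deg i)) =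
      (LinearMap.mul k (Poly k deg)) ∘ₗ (P.bracket (Poly.x k deg i)) +
      (LinearMap.mul k (Poly k deg)).compl₁₂ (Poly.twist i).toLinearMap
        (P.bracket (Poly.x k deg i)) := by
    refine Poly.linearMap_ext fun p a ha => Poly.linearMap_ext fun q b hb => ?_
    simp [P.bracket_mul _ p q _ (Poly.x_mem i) a ha b hb, Poly.twist_of_mem i ha]
  exact DFunLike.congr_fun (DFunLike.congr_fun h a) b

end DGPoissonStructure

end Bracket

/-! ### Hamiltonian maps into an arbitrary algebra, and their curvature -/

section Hamiltonian

variable {k : Type*} [Field k] {n : ℕ} {deg : Fin n → ℤ}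
  {A : Type*} [Ring A] [Algebra k A] (ρ : Poly k deg →ₐ[k] A) (Y : Fin n → A)

/-- The linear map `a ↦ ∑_r ψ_r(a) Y_r`. -/
def hamiltonian : Poly k deg →ₗ[k] A :=
  ∑ r, LinearMap.mulRight k (Y r) ∘ₗ ρ.toLinearMap ∘ₗ Poly.psi r

theorem hamiltonian_apply (a : Poly k deg) :
    hamiltonian ρ Y a = ∑ r, ρ (Poly.psi r a) * Y r := by
  simp [hamiltonian]

theorem hamiltonian_x (i : Fin n) : hamiltonian ρ Y (Poly.x k deg i) = Y i := by
  rw [hamiltonian_apply, Finset.sum_eq_single i]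
  · simp [Poly.psi_x]
  · intro r _ hr
    simp [Poly.psi_x, hr.symm]
  · simp

theorem hamiltonian_one : hamiltonian ρ Y 1 = 0 := by
  simp [hamiltonian_apply, Poly.psi_one]

/-- Inherited from each `ψ_r`. The elements `Y r` satisfy no relation here, so this serves `F(R)`,
`R^e` and the operators on the standard module alike. -/
theorem hamiltonian_mul {p q : ℤ} {a b : Poly k deg} (ha : a ∈ Poly.grading k deg p)
    (hb : b ∈ Poly.grading k deg q) :
    hamiltonian ρ Y (a * b) =
      ρ a * hamiltonian ρ Y b + (-1 : k) ^ (p * q) • (ρ b * hamiltonian ρ Y a) := by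
  simp only [hamiltonian_apply, Poly.psi_mul _ ha hb, map_add, map_smul, map_mul, add_mul,
    smul_mul_assoc, Finset.sum_add_distrib, Finset.mul_sum, Finset.smul_sum, mul_assoc]

variable (P : DGPoissonStructure (Poly.grading k deg))

/-- The relations `Y_i x_j = (-1)^{|x_i||x_j|} x_j Y_i + {x_i, x_j}`. -/
def IsConnection : Prop :=
  ∀ i j, Y i * ρ (Poly.x k deg j) = (-1 : k) ^ (deg i * deg j) • (ρ (Poly.x k deg j) * Y i) +
    ρ (P.bracket (Poly.x k deg i) (Poly.x k deg j))

variable {ρ Y P}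

/-- `Y i` passes the generators in a word one at a time, and the Leibniz rule of `{x_i, -}` collects
the brackets. -/
theorem IsConnection.mul_apply (hY : IsConnection ρ Y P) (i : Fin n) {p : ℤ} {a : Poly k deg}
    (ha : a ∈ Poly.grading k deg p) :
    Y i * ρ a = (-1 : k) ^ (deg i * p) • (ρ a * Y i) + ρ (P.bracket (Poly.x k deg i) a) := by
  induction ha using Poly.homogeneous_induction with
  | one => simp [P.bracket_one (Poly.x_mem i)]
  | x_mul j p a ha ih =>
    rw [map_mul, ← mul_assoc, hY i j, add_mul, smul_mul_assoc, mul_assoc, ih,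
      P.bracket_mul _ _ p _ (Poly.x_mem i) _ (Poly.x_mem j) a ha]
    simp only [map_add, map_mul, map_smul, mul_add, smul_add, mul_smul_comm, smul_smul,
      neg_one_zpow_add, mul_assoc]
    abel
  | zero => simp
  | add p a b ha hb iha ihb => simp only [map_add, mul_add, add_mul, iha, ihb, smul_add]; abel
  | smul p c a ha ih =>
    simp only [map_smul, mul_smul_comm, smul_mul_assoc, ih, smul_add]
    rw [smul_comm]

theorem IsConnection.hamiltonian_mul_apply (hY : IsConnection ρ Y P) {p q : ℤ}
    {a b : Poly k deg} (ha : a ∈ Poly.grading k deg p) (hb : b ∈ Poly.grading k deg q) :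
    hamiltonian ρ Y a * ρ b =
      (-1 : k) ^ (p * q) • (ρ b * hamiltonian ρ Y a) + ρ (P.bracket a b) := by
  induction ha using Poly.homogeneous_induction with
  | one =>
    have h := P.antisymm 0 q 1 SetLike.GradedOne.one_mem b hb
    rw [P.bracket_one hb] at h
    simp [hamiltonian_one, h]
  | x_mul i p a ha ih =>
    have hc : ρ (Poly.x k deg i) * ρ b = (-1 : k) ^ (deg i * q) • (ρ b * ρ (Poly.x k deg i)) := by
      rw [← map_mul, Poly.graded_comm (Poly.x_mem i) hb, map_smul, map_mul]
    have hc' : ρ a * ρ b = (-1 : k) ^ (p * q) • (ρ b * ρ a) := by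
      rw [← map_mul, Poly.graded_comm ha hb, map_smul, map_mul]
    rw [hamiltonian_mul ρ Y (Poly.x_mem i) ha, P.mul_bracket (Poly.x_mem i) ha hb, hamiltonian_x,
      add_mul, smul_mul_assoc, mul_assoc, mul_assoc, ih, hY.mul_apply i hb]
    simp only [map_add, map_mul, map_smul, mul_add, smul_add, mul_smul_comm, smul_smul,
      neg_one_zpow_add, add_mul, ← mul_assoc, hc, hc', smul_mul_assoc]
    rw [show (-1 : k) ^ (deg i * p) * (-1) ^ (deg i * q) * (-1) ^ (p * q) =
      (-1 : k) ^ (deg i * q) * (-1) ^ (p * q) * (-1) ^ (deg i * p) by ring,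
      show (-1 : k) ^ (p * q) * (-1) ^ (deg i * q) = (-1) ^ (deg i * q) * (-1) ^ (p * q) by ring]
    abel
  | zero => simp
  | add p a c ha hc iha ihc =>
    simp only [map_add, mul_add, add_mul, iha, ihc, smul_add, LinearMap.add_apply]; abel
  | smul p c a ha ih =>
    simp only [map_smul, mul_smul_comm, smul_mul_assoc, ih, smul_add, LinearMap.smul_apply]
    rw [smul_comm]

variable (ρ Y P) in
/-- The defect of the relation `H(a) H(b) - (-1)^{|a||b|} H(b) H(a) = H({a, b})` for elements `a`,
`b` of degrees `p`, `q`. -/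
def curvature (p q : ℤ) (a b : Poly k deg) : A :=
  hamiltonian ρ Y a * hamiltonian ρ Y b - (-1 : k) ^ (p * q) •
    (hamiltonian ρ Y b * hamiltonian ρ Y a) - hamiltonian ρ Y (P.bracket a b)

theorem curvature_symm {p q : ℤ} {a b : Poly k deg} (ha : a ∈ Poly.grading k deg p)
    (hb : b ∈ Poly.grading k deg q) :
    curvature ρ Y P p q a b = -((-1 : k) ^ (p * q) • curvature ρ Y P q p b a) := by
  rw [curvature, curvature, P.antisymm p q a ha b hb, mul_comm q p]
  simp only [map_neg, map_smul, smul_sub, smul_smul, Poly.sign_mul_self, one_smul]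
  abel

/-- The terms in which a bracket stands outside `hamiltonian` cancel against those of `{a, bc}`.
Thus the curvature is a derivation in its second argument with coefficients on the left, and is
determined by its values on generators. -/
theorem IsConnection.curvature_mul (hY : IsConnection ρ Y P) {p q r : ℤ} {a b c : Poly k deg}
    (ha : a ∈ Poly.grading k deg p) (hb : b ∈ Poly.grading k deg q)
    (hc : c ∈ Poly.grading k deg r) :
    curvature ρ Y P p (q + r) a (b * c) =
      (-1 : k) ^ (p * q) • (ρ b * curvature ρ Y P p r a c) +
      ((-1 : k) ^ (q * r) * (-1 : k) ^ (p * r)) • (ρ c * curvature ρ Y P p q a b) := by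
  have e1 : hamiltonian ρ Y a * (ρ b * hamiltonian ρ Y c) =
      ((-1 : k) ^ (p * q) • (ρ b * hamiltonian ρ Y a) + ρ (P.bracket a b)) *
        hamiltonian ρ Y c := by
    rw [← mul_assoc, hY.hamiltonian_mul_apply ha hb]
  have e2 : hamiltonian ρ Y a * (ρ c * hamiltonian ρ Y b) =
      ((-1 : k) ^ (p * r) • (ρ c * hamiltonian ρ Y a) + ρ (P.bracket a c)) *
        hamiltonian ρ Y b := by
    rw [← mul_assoc, hY.hamiltonian_mul_apply ha hc]
  rw [curvature, curvature, curvature, P.bracket_mul p q r a ha b hb c hc, map_add, map_smul,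
    hamiltonian_mul ρ Y hb hc, hamiltonian_mul ρ Y (P.bracket_mem p q a ha b hb) hc,
    hamiltonian_mul ρ Y hb (P.bracket_mem p r a ha c hc), mul_add, mul_smul_comm, e1, e2]
  simp only [mul_add, add_mul, smul_add, mul_sub, smul_sub, mul_smul_comm, smul_mul_assoc,
    smul_smul, neg_one_zpow_add, mul_assoc, mul_comm q p]
  rcases neg_one_zpow_cases (k := k) (p * q) with h1 | h1 <;>
  rcases neg_one_zpow_cases (k := k) (p * r) with h2 | h2 <;>
  rcases neg_one_zpow_cases (k := k) (q * r) with h3 | h3 <;>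
  simp only [h1, h2, h3, one_smul, neg_smul, mul_one, mul_neg, neg_neg] <;> abel

/-- If a left ideal contains the defects for the generators, it contains them all. -/
theorem IsConnection.curvature_mem (hY : IsConnection ρ Y P) (I : Submodule A A)
    (hI : ∀ i j, curvature ρ Y P (deg i) (deg j) (Poly.x k deg i) (Poly.x k deg j) ∈ I)
    {p q : ℤ} {a b : Poly k deg} (ha : a ∈ Poly.grading k deg p)
    (hb : b ∈ Poly.grading k deg q) : curvature ρ Y P p q a b ∈ I := by
  have hsmul : ∀ (c : k) (u : A), u ∈ I → c • u ∈ I := fun c u hu => by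
    rw [Algebra.smul_def]; exact I.smul_mem _ hu
  have key : ∀ {p : ℤ} {a : Poly k deg}, a ∈ Poly.grading k deg p →
      (∀ j, curvature ρ Y P p (deg j) a (Poly.x k deg j) ∈ I) →
      ∀ {q : ℤ} {b : Poly k deg}, b ∈ Poly.grading k deg q → curvature ρ Y P p q a b ∈ I := by
    intro p a ha h q b hb
    induction hb using Poly.homogeneous_induction with
    | one => simp [curvature, hamiltonian_one, P.bracket_one ha]
    | x_mul j q b hb ih =>
      rw [hY.curvature_mul ha (Poly.x_mem j) hb]
      exact I.add_mem (hsmul _ _ (I.smul_mem _ ih)) (hsmul _ _ (I.smul_mem _ (h j)))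
    | zero => simp [curvature]
    | add q b c hb hc ihb ihc =>
      convert I.add_mem ihb ihc using 1
      simp only [curvature, map_add, mul_add, add_mul, smul_add]
      abel
    | smul q c b hb ih =>
      convert hsmul c _ ih using 1
      simp only [curvature, map_smul, mul_smul_comm, smul_mul_assoc, smul_sub]
      rw [smul_comm]
  -- `key` treats the second argument only; symmetry puts `a` there, so it is applied twice.
  refine key ha (fun j => ?_) hb
  rw [curvature_symm ha (Poly.x_mem j)]
  exact I.neg_mem (hsmul _ _ (key (Poly.x_mem j) (hI j) ha))

/-- Passing `ρ c` through both products leaves double brackets, which cancel by the Jacobi identity.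
Hence an operator-valued curvature that kills a vector also kills its `R`-multiples. -/
theorem IsConnection.curvature_mul_apply (hY : IsConnection ρ Y P) {p q r : ℤ}
    {a b c : Poly k deg} (ha : a ∈ Poly.grading k deg p) (hb : b ∈ Poly.grading k deg q)
    (hc : c ∈ Poly.grading k deg r) :
    curvature ρ Y P p q a b * ρ c =
      (-1 : k) ^ ((p + q) * r) • (ρ c * curvature ρ Y P p q a b) := by
  have hJ := congrArg ρ (P.jacobi p q r a ha b hb c hc)
  rw [map_add, map_smul] at hJ
  rw [curvature, sub_mul, sub_mul, smul_mul_assoc, mul_assoc, mul_assoc,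
    hY.hamiltonian_mul_apply ha hc, hY.hamiltonian_mul_apply hb hc,
    hY.hamiltonian_mul_apply (P.bracket_mem p q a ha b hb) hc]
  simp only [mul_add, mul_smul_comm, ← mul_assoc, hY.hamiltonian_mul_apply ha hc,
    hY.hamiltonian_mul_apply hb hc, hY.hamiltonian_mul_apply ha (P.bracket_mem q r b hb c hc),
    hY.hamiltonian_mul_apply hb (P.bracket_mem p r a ha c hc), hJ]
  simp only [add_mul, smul_add, mul_sub, smul_sub, mul_smul_comm, smul_mul_assoc,
    smul_smul, neg_one_zpow_add, mul_assoc, mul_comm q p]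
  rcases neg_one_zpow_cases (k := k) (p * q) with h1 | h1 <;>
  rcases neg_one_zpow_cases (k := k) (p * r) with h2 | h2 <;>
  rcases neg_one_zpow_cases (k := k) (q * r) with h3 | h3 <;>
  simp only [h1, h2, h3, one_smul, neg_smul, mul_one, mul_neg, neg_neg] <;> abel

end Hamiltonian

/-! ### Derivations as triangular matrices -/

section LeibnizMatrix

variable {k : Type*} [Field k] {A : Type*} [Ring A] [Algebra k A]

/-- The matrix recording an element `a` of degree `p` and the value `a'` of an odd derivation. -/
def leibnizMatrix (k : Type*) [Field k] {A : Type*} [Ring A] [Algebra k A] (p : ℤ) (a a' : A) :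
    Matrix (Fin 2) (Fin 2) A :=
  !![(-1 : k) ^ p • a, a'; 0, a]

/-- The upper right entry is the graded Leibniz rule, so a derivation can be defined by its values
on generators and a check of the relations. -/
theorem leibnizMatrix_mul (p q : ℤ) (a a' b b' : A) :
    leibnizMatrix k p a a' * leibnizMatrix k q b b' =
      leibnizMatrix k (p + q) (a * b) (a' * b + (-1 : k) ^ p • (a * b')) := by
  simp [leibnizMatrix, neg_one_zpow_add, add_comm, smul_smul]

theorem leibnizMatrix_add (p : ℤ) (a a' b b' : A) :
    leibnizMatrix k p a a' + leibnizMatrix k p b b' = leibnizMatrix k p (a + b) (a' + b') := by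
  simp [leibnizMatrix, Matrix.of_add_of]

theorem leibnizMatrix_smul (p : ℤ) (c : k) (a a' : A) :
    c • leibnizMatrix k p a a' = leibnizMatrix k p (c • a) (c • a') := by
  simp [leibnizMatrix, Matrix.smul_of, smul_smul, mul_comm]

theorem leibnizMatrix_sub (p : ℤ) (a a' b b' : A) :
    leibnizMatrix k p a a' - leibnizMatrix k p b b' = leibnizMatrix k p (a - b) (a' - b') := by
  simp [leibnizMatrix, Matrix.of_sub_of, smul_sub]

theorem leibnizMatrix_zero (p : ℤ) : leibnizMatrix k p (0 : A) 0 = 0 := by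
  ext i j
  fin_cases i <;> fin_cases j <;> simp [leibnizMatrix]

theorem leibnizMatrix_one : leibnizMatrix k 0 (1 : A) 0 = 1 := by
  simp [leibnizMatrix, Matrix.one_fin_two]

end LeibnizMatrix

/-! ### The differential of `R^e` -/

section Differential

variable {k : Type*} [Field k] {n : ℕ} {deg : Fin n → ℤ}
  (P : DGPoissonStructure (Poly.grading k deg))

namespace Env

theorem h_eq_hamiltonian : h P = hamiltonian (m P) (y P) := by
  ext f
  simp [h, FreeExt.psi_apply, hamiltonian_apply, m, y]

theorem isConnection : IsConnection (m P) (y P) P := fun i j => y_mul_x i j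

theorem h_mul {p q : ℤ} {a b : Poly k deg} (ha : a ∈ Poly.grading k deg p)
    (hb : b ∈ Poly.grading k deg q) :
    h P (a * b) = m P a * h P b + (-1 : k) ^ (p * q) • (m P b * h P a) := by
  rw [h_eq_hamiltonian, hamiltonian_mul _ _ ha hb]

theorem h_x (i : Fin n) : h P (Poly.x k deg i) = y P i := by
  rw [h_eq_hamiltonian, hamiltonian_x]

theorem h_mul_m {p q : ℤ} {a b : Poly k deg} (ha : a ∈ Poly.grading k deg p)
    (hb : b ∈ Poly.grading k deg q) :
    h P a * m P b = (-1 : k) ^ (p * q) • (m P b * h P a) + m P (P.bracket a b) := by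
  rw [h_eq_hamiltonian, (isConnection P).hamiltonian_mul_apply ha hb]

/-- The defining relations say that the curvature vanishes on generators; `curvature_mem` for the
zero ideal extends this to all homogeneous elements. -/
theorem h_mul_h {p q : ℤ} {a b : Poly k deg} (ha : a ∈ Poly.grading k deg p)
    (hb : b ∈ Poly.grading k deg q) :
    h P a * h P b = (-1 : k) ^ (p * q) • (h P b * h P a) + h P (P.bracket a b) := by
  have e : curvature (m P) (y P) P p q a b ∈ (⊥ : Submodule (Env P) (Env P)) :=
    (isConnection P).curvature_mem ⊥ (fun i j => by
      rw [Submodule.mem_bot, curvature, hamiltonian_x, hamiltonian_x, ← h_eq_hamiltonian,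
        y_mul_y i j]
      abel) ha hb
  rw [Submodule.mem_bot, curvature, ← h_eq_hamiltonian, sub_sub, sub_eq_zero] at e
  exact e

variable {P} in
theorem h_mem {p : ℤ} {f : Poly k deg} (hf : f ∈ Poly.grading k deg p) :
    h P f ∈ grading P p := by
  rw [h_eq_hamiltonian, hamiltonian_apply]
  refine Submodule.sum_mem _ fun r _ => ?_
  have e := SetLike.mul_mem_graded (m_mem (P := P) (Poly.psiMatrix_of_mem r hf).2.2)
    (y_mem (P := P) r)
  rwa [sub_add_cancel] at e

/-- The algebra map `a ↦ !![(-1)^{|a|} a, δ(a); 0, a]` on `F(R)`. -/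
def leibnizHomFree : FreeExt k deg →ₐ[k] Matrix (Fin 2) (Fin 2) (Env P) :=
  FreeExt.lift (fun i => leibnizMatrix k (deg i) (x P i) (m P (P.d (Poly.x k deg i))))
    (fun i => leibnizMatrix k (deg i) (y P i) (h P (P.d (Poly.x k deg i)))) (by
      intro i j
      have hx (i : Fin n) := Poly.x_mem (k := k) (deg := deg) i
      -- The corner entries agree because `d` is already defined on `R`, where the generators
      -- commute up to sign.
      have e := congrArg (fun f => m P (P.d f)) (Poly.x_comm (k := k) (deg := deg) i j)
      simp only [map_smul, P.isDGAlgebra.leibniz _ _ (hx _), map_add, map_mul] at e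
      rw [leibnizMatrix_mul, leibnizMatrix_mul, leibnizMatrix_smul, ← x_comm, add_comm (deg j)]
      exact congrArg _ e)

theorem leibnizHomFree_incl {p : ℤ} {f : Poly k deg} (hf : f ∈ Poly.grading k deg p) :
    leibnizHomFree P (FreeExt.incl f) = leibnizMatrix k p (m P f) (m P (P.d f)) := by
  induction hf using Poly.homogeneous_induction with
  | one => simp [P.d_one, leibnizMatrix_one]
  | x_mul i p a ha ih =>
    rw [map_mul, map_mul, ih, FreeExt.incl, Poly.lift_x, leibnizHomFree, FreeExt.lift_x,
      leibnizMatrix_mul, P.isDGAlgebra.leibniz _ _ (Poly.x_mem i)]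
    simp [x]
  | zero => simp [leibnizMatrix_zero]
  | add p a b ha hb iha ihb => simp only [map_add, iha, ihb, leibnizMatrix_add]
  | smul p c a ha ih => simp only [map_smul, ih, leibnizMatrix_smul]

theorem freeExt_psi_eq : FreeExt.psi = hamiltonian (FreeExt.incl (k := k) (deg := deg))
    (FreeExt.y k deg) := rfl

/-- The corner entry says that the prescribed `δ` commutes with `h`. It is needed on `F(R)` already,
since the relations of `R^e` involve `ψ` of a bracket. -/
theorem leibnizHomFree_psi {p : ℤ} {f : Poly k deg} (hf : f ∈ Poly.grading k deg p) :
    leibnizHomFree P (FreeExt.psi f) = leibnizMatrix k p (h P f) (h P (P.d f)) := by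
  induction hf using Poly.homogeneous_induction with
  | one => simp [P.d_one, freeExt_psi_eq, hamiltonian_one, h_eq_hamiltonian, leibnizMatrix_zero]
  | x_mul i p a ha ih =>
    have hx := Poly.x_mem (k := k) (deg := deg) i
    have hd := P.isDGAlgebra.map_mem
    rw [P.isDGAlgebra.leibniz _ _ hx, map_add, map_smul, h_mul P (hd _ _ hx) ha,
      h_mul P hx (hd _ _ ha), h_mul P hx ha, h_x]
    rw [freeExt_psi_eq] at ih ⊢
    rw [hamiltonian_mul _ _ hx ha, map_add, map_smul, map_mul, map_mul, ih, hamiltonian_x,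
      leibnizHomFree_incl P hx, leibnizHomFree_incl P ha, leibnizHomFree, FreeExt.lift_y,
      leibnizMatrix_mul, leibnizMatrix_mul, leibnizMatrix_smul, add_comm p, leibnizMatrix_add]
    congr 1
    simp only [smul_add, smul_smul, mul_add, add_mul, one_mul, mul_one, neg_one_zpow_add]
    rcases neg_one_zpow_cases (k := k) (deg i * p) with h1 | h1 <;>
    rcases neg_one_zpow_cases (k := k) (deg i) with h2 | h2 <;>
    simp only [h1, h2, one_smul, neg_smul, one_mul, neg_mul, mul_neg, neg_neg] <;> abel
  | zero => simp [leibnizMatrix_zero]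
  | add p a b ha hb iha ihb => simp only [map_add, iha, ihb, leibnizMatrix_add]
  | smul p c a ha ih => simp only [map_smul, ih, leibnizMatrix_smul]

theorem leibnizHomFree_y (i : Fin n) : leibnizHomFree P (FreeExt.y k deg i) =
    leibnizMatrix k (deg i) (y P i) (h P (P.d (Poly.x k deg i))) := by
  rw [leibnizHomFree, FreeExt.lift_y]

theorem leibnizHomFree_x (i : Fin n) : leibnizHomFree P (FreeExt.x k deg i) =
    leibnizMatrix k (deg i) (x P i) (m P (P.d (Poly.x k deg i))) := by
  rw [leibnizHomFree, FreeExt.lift_x]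

/-- The corner of a relation for `(x_i, x_j)` is the sum of those for `(d x_i, x_j)` and `(x_i, d
x_j)`. Here `d x_i` is not a generator, which is why the commutation rules were extended;
`d_bracket` matches the bracket terms. -/
theorem leibnizHomFree_rel {a b : FreeExt k deg} (hab : EnvRel P a b) :
    leibnizHomFree P a = leibnizHomFree P b := by
  have hx (i : Fin n) := Poly.x_mem (k := k) (deg := deg) i
  have hd (i : Fin n) := P.isDGAlgebra.map_mem _ _ (hx i)
  cases hab with
  | yy i j =>
    have e1 := h_mul_h P (hx i) (hd j)
    have e2 := h_mul_h P (hd i) (hx j)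
    rw [h_x] at e1 e2
    rw [map_sub, map_sub, map_smul, map_mul, map_mul, map_zero,
      leibnizHomFree_psi P (P.bracket_mem _ _ _ (hx i) _ (hx j)), leibnizHomFree_y,
      leibnizHomFree_y, leibnizMatrix_mul, leibnizMatrix_mul, leibnizMatrix_smul,
      add_comm (deg j), leibnizMatrix_sub, leibnizMatrix_sub,
      ← leibnizMatrix_zero (k := k) (deg i + deg j)]
    congr 1
    · rw [y_mul_y i j]; abel
    · rw [e1, e2, P.d_bracket _ _ _ (hx i) _ (hx j), map_add, map_smul]
      simp only [smul_add, smul_smul, mul_add, add_mul, one_mul, mul_one, neg_one_zpow_add]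
      rcases neg_one_zpow_cases (k := k) (deg i * deg j) with h1 | h1 <;>
      rcases neg_one_zpow_cases (k := k) (deg i) with h2 | h2 <;>
      rcases neg_one_zpow_cases (k := k) (deg j) with h3 | h3 <;>
      simp only [h1, h2, h3, one_smul, neg_smul, mul_neg, neg_neg, mul_one] <;>
      abel
  | yx i j =>
    have e1 := h_mul_m P (hx i) (hd j)
    have e2 := h_mul_m P (hd i) (hx j)
    rw [h_x] at e1
    rw [map_sub, map_sub, map_smul, map_mul, map_mul, map_zero,
      leibnizHomFree_incl P (P.bracket_mem _ _ _ (hx i) _ (hx j)), leibnizHomFree_y,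
      leibnizHomFree_x, leibnizMatrix_mul, leibnizMatrix_mul, leibnizMatrix_smul,
      add_comm (deg j), leibnizMatrix_sub, leibnizMatrix_sub,
      ← leibnizMatrix_zero (k := k) (deg i + deg j)]
    congr 1
    · rw [y_mul_x i j]; abel
    · rw [e1, x, e2, P.d_bracket _ _ _ (hx i) _ (hx j), map_add, map_smul]
      change _ - _ • (_ + _ • (x P j * _)) - _ = _
      rw [show m P (Poly.x k deg j) = x P j from rfl]
      simp only [smul_add, smul_smul, mul_add, add_mul, one_mul, mul_one, neg_one_zpow_add]
      rcases neg_one_zpow_cases (k := k) (deg i * deg j) with h1 | h1 <;>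
      rcases neg_one_zpow_cases (k := k) (deg i) with h2 | h2 <;>
      rcases neg_one_zpow_cases (k := k) (deg j) with h3 | h3 <;>
      simp only [h1, h2, h3, one_smul, neg_smul, mul_neg, neg_neg, mul_one] <;>
      abel

/-- The algebra map `a ↦ !![(-1)^{|a|} a, δ(a); 0, a]` on `R^e`. -/
def leibnizHom : Env P →ₐ[k] Matrix (Fin 2) (Fin 2) (Env P) :=
  RingQuot.liftAlgHom k ⟨leibnizHomFree P, fun _ _ hab => leibnizHomFree_rel P hab⟩

theorem leibnizHom_mk (z : FreeExt k deg) : leibnizHom P (mk P z) = leibnizHomFree P z :=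
  RingQuot.liftAlgHom_mkAlgHom_apply k _ _ _

/-- The differential of `R^e`. -/
def diff : Env P →ₗ[k] Env P where
  toFun a := leibnizHom P a 0 1
  map_add' := by simp
  map_smul' := by simp

theorem diff_m (f : Poly k deg) : diff P (m P f) = m P (P.d f) := by
  have e : diff P ∘ₗ (m P).toLinearMap = (m P).toLinearMap ∘ₗ P.d :=
    Poly.linearMap_ext fun p a ha => by
      change leibnizHom P (mk P (FreeExt.incl a)) 0 1 = _
      rw [leibnizHom_mk, leibnizHomFree_incl P ha]
      rfl
  exact DFunLike.congr_fun e f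

theorem diff_h (f : Poly k deg) : diff P (h P f) = h P (P.d f) := by
  have e : diff P ∘ₗ h P = h P ∘ₗ P.d :=
    Poly.linearMap_ext fun p a ha => by
      change leibnizHom P (mk P (FreeExt.psi a)) 0 1 = _
      rw [leibnizHom_mk, leibnizHomFree_psi P ha]
      rfl
  exact DFunLike.congr_fun e f

theorem diff_y (i : Fin n) : diff P (y P i) = h P (P.d (Poly.x k deg i)) := by
  rw [← h_x, diff_h]

variable {P} in
/-- To prove a linear property of homogeneous elements of `R^e`, it suffices to treat `1` and
left products with generators. -/
theorem homogeneous_induction {Q : ∀ (p : ℤ) (a : Env P), a ∈ grading P p → Prop}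
    (one : Q 0 1 SetLike.GradedOne.one_mem)
    (x_mul : ∀ i p a (ha : a ∈ grading P p), Q p a ha →
      Q (deg i + p) (x P i * a) (SetLike.mul_mem_graded (x_mem i) ha))
    (y_mul : ∀ i p a (ha : a ∈ grading P p), Q p a ha →
      Q (deg i + p) (y P i * a) (SetLike.mul_mem_graded (y_mem i) ha))
    (zero : ∀ p, Q p 0 (Submodule.zero_mem _))
    (add : ∀ p a b (ha : a ∈ grading P p) (hb : b ∈ grading P p), Q p a ha → Q p b hb →
      Q p (a + b) (Submodule.add_mem _ ha hb))
    (smul : ∀ p (c : k) a (ha : a ∈ grading P p), Q p a ha →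
      Q p (c • a) (Submodule.smul_mem _ c ha))
    {p : ℤ} {a : Env P} (ha : a ∈ grading P p) : Q p a ha := by
  induction ha using Submodule.span_induction with
  | mem a h =>
    obtain ⟨l, rfl, rfl⟩ := h
    induction l with
    | nil => exact one
    | cons i l ih =>
      cases i with
      | inl i => exact x_mul i _ _ _ ih
      | inr i => exact y_mul i _ _ _ ih
  | zero => exact zero p
  | add a b ha hb iha ihb => exact add p a b ha hb iha ihb
  | smul c a ha iha => exact smul p c a ha iha

variable {P} in
/-- Two linear maps on `R^e` agree if they agree on homogeneous elements. -/
theorem linearMap_ext {V : Type*} [AddCommGroup V] [Module k V] {φ φ' : Env P →ₗ[k] V}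
    (h : ∀ p, ∀ a ∈ grading P p, φ a = φ' a) : φ = φ' := by
  ext a
  induction a using DirectSum.Decomposition.inductionOn (grading P) with
  | zero => simp
  | homogeneous a => exact h _ a a.2
  | add a b iha ihb => rw [map_add, map_add, iha, ihb]

variable {P} in
theorem leibnizHom_x (i : Fin n) : leibnizHom P (x P i) =
    leibnizMatrix k (deg i) (x P i) (diff P (x P i)) := by
  rw [← mk_x, leibnizHom_mk, leibnizHomFree_x, mk_x, x, diff_m]

variable {P} in
theorem leibnizHom_y (i : Fin n) : leibnizHom P (y P i) =
    leibnizMatrix k (deg i) (y P i) (diff P (y P i)) := by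
  rw [diff_y, ← leibnizHomFree_y, ← leibnizHom_mk]
  rfl

variable {P} in
theorem leibnizHom_of_mem {p : ℤ} {a : Env P} (ha : a ∈ grading P p) :
    leibnizHom P a = leibnizMatrix k p a (diff P a) := by
  -- The corner entry is `diff` by definition, so the induction may produce any value there.
  have e (a : Env P) {p : ℤ} {b b' : Env P} (h : leibnizHom P a = leibnizMatrix k p b b') :
      leibnizHom P a = leibnizMatrix k p b (diff P a) := by
    have : diff P a = b' := by
      change leibnizHom P a 0 1 = _
      rw [h]
      rfl
    rw [this, h]
  refine e _ (b' := diff P a) ?_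
  induction ha using homogeneous_induction with
  | one => exact e _ (b' := 0) (by rw [map_one, leibnizMatrix_one])
  | x_mul i p a ha ih => exact e _ (by rw [map_mul, ih, leibnizHom_x, leibnizMatrix_mul])
  | y_mul i p a ha ih => exact e _ (by rw [map_mul, ih, leibnizHom_y, leibnizMatrix_mul])
  | zero => simp [leibnizMatrix_zero]
  | add p a b ha hb iha ihb => simp only [map_add, iha, ihb, leibnizMatrix_add]
  | smul p c a ha ih => simp only [map_smul, ih, leibnizMatrix_smul]

theorem diff_mul {p : ℤ} {a : Env P} (ha : a ∈ grading P p) (b : Env P) :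
    diff P (a * b) = diff P a * b + (-1 : k) ^ p • (a * diff P b) := by
  have e : diff P ∘ₗ LinearMap.mulLeft k a = LinearMap.mulLeft k (diff P a) +
      (-1 : k) ^ p • (LinearMap.mulLeft k a ∘ₗ diff P) := linearMap_ext fun q b hb => by
    change leibnizHom P (a * b) 0 1 = _
    rw [map_mul, leibnizHom_of_mem ha, leibnizHom_of_mem hb, leibnizMatrix_mul]
    rfl
  exact DFunLike.congr_fun e b

variable {P} in
theorem diff_one : diff P 1 = 0 := by
  have := diff_m P 1
  rwa [P.d_one, map_one, map_zero] at this

theorem diff_mem {p : ℤ} {a : Env P} (ha : a ∈ grading P p) : diff P a ∈ grading P (p + 1) := by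
  have hd (i : Fin n) := P.isDGAlgebra.map_mem _ _ (Poly.x_mem (k := k) (deg := deg) i)
  induction ha using homogeneous_induction with
  | one => rw [diff_one]; exact Submodule.zero_mem _
  | x_mul i p a ha ih =>
    rw [diff_mul P (x_mem i)]
    refine Submodule.add_mem _ ?_ (Submodule.smul_mem _ _ ?_)
    · rw [x, diff_m, add_right_comm]
      exact SetLike.mul_mem_graded (m_mem (hd i)) ha
    · rw [add_assoc]
      exact SetLike.mul_mem_graded (x_mem i) ih
  | y_mul i p a ha ih =>
    rw [diff_mul P (y_mem i)]
    refine Submodule.add_mem _ ?_ (Submodule.smul_mem _ _ ?_)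
    · rw [diff_y, add_right_comm]
      exact SetLike.mul_mem_graded (h_mem (hd i)) ha
    · rw [add_assoc]
      exact SetLike.mul_mem_graded (y_mem i) ih
  | zero => simp
  | add p a b ha hb iha ihb => rw [map_add]; exact Submodule.add_mem _ iha ihb
  | smul p c a ha ih => rw [map_smul]; exact Submodule.smul_mem _ _ ih

theorem diff_diff (a : Env P) : diff P (diff P a) = 0 := by
  have e : diff P ∘ₗ diff P = 0 := linearMap_ext fun p a ha => by
    -- The mixed terms of `δ²` on a product cancel, as `δ a` has degree `p + 1`; so it suffices to
    -- have `δ² = 0` on generators.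
    have step {p : ℤ} {a b : Env P} (ha : a ∈ grading P p) (h1 : diff P (diff P a) = 0)
        (h2 : diff P (diff P b) = 0) : diff P (diff P (a * b)) = 0 := by
      rw [diff_mul P ha, map_add, map_smul, diff_mul P ha, diff_mul P (diff_mem P ha), h1, h2,
        neg_one_zpow_add]
      simp
    simp only [LinearMap.comp_apply, LinearMap.zero_apply]
    induction ha using homogeneous_induction with
    | one => rw [diff_one, map_zero]
    | x_mul i p a ha ih =>
      exact step (x_mem i)
        (by rw [x, diff_m, diff_m, P.isDGAlgebra.sq_zero, map_zero]) ih
    | y_mul i p a ha ih =>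
      exact step (y_mem i)
        (by rw [diff_y, diff_h, P.isDGAlgebra.sq_zero, map_zero]) ih
    | zero => simp
    | add p a b ha hb iha ihb => rw [map_add, map_add, iha, ihb, add_zero]
    | smul p c a ha ih => rw [map_smul, map_smul, ih, smul_zero]
  exact DFunLike.congr_fun e a

theorem isDGAlgebra : IsDGAlgebra (grading P) (diff P) where
  map_mem _ _ ha := diff_mem P ha
  sq_zero := diff_diff P
  leibniz _ _ ha b := diff_mul P ha b

theorem isLeftDGModule :
    IsLeftDGModule (Poly.grading k deg) P.d (grading P) (diff P) where
  isInternal := DirectSum.Decomposition.isInternal _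
  smul_mem _ _ _ ha _ hm := SetLike.mul_mem_graded (m_mem ha) hm
  map_mem _ _ hm := diff_mem P hm
  sq_zero := diff_diff P
  leibniz p a ha u := by
    rw [smul_def, smul_def, smul_def, diff_mul P (m_mem ha), diff_m]

theorem isRightDGModule :
    IsRightDGModule (Poly.grading k deg) P.d (grading P) (diff P) where
  isInternal := DirectSum.Decomposition.isInternal _
  smul_mem _ _ _ hm _ ha := SetLike.mul_mem_graded hm (m_mem ha)
  map_mem _ _ hm := diff_mem P hm
  sq_zero := diff_diff P
  leibniz p u hu a := by
    rw [op_smul_def, op_smul_def, op_smul_def, diff_mul P hu, diff_m]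

end Env

end Differential

/-! ### Standard words -/

section StandardWords

variable (k : Type*) [Field k] {n : ℕ} (deg : Fin n → ℤ)

/-- The indices `i` such that `x_i` squares to zero: `|x_i|` is odd and the characteristic is
not `2`. -/
def IsFermionic (i : Fin n) : Prop := Odd (deg i) ∧ (2 : k) ≠ 0

/-- `y_i` may stand immediately to the left of `y_j` in a standard monomial. -/
def Precedes (i j : Fin n) : Prop := i < j ∨ i = j ∧ ¬ IsFermionic k deg i

/-- Standard words: increasing lists of indices without repetition of fermionic ones. -/
def StdWord : Type := {l : List (Fin n) // l.Pairwise (Precedes k deg)}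

variable {k deg}

theorem Precedes.le {i j : Fin n} (h : Precedes k deg i j) : i ≤ j := by
  rcases h with h | ⟨h, -⟩
  exacts [h.le, h.le]

theorem Precedes.of_lt_of_precedes {i j l : Fin n} (h : i < j) (h' : Precedes k deg j l) :
    Precedes k deg i l := Or.inl (h.trans_le h'.le)

theorem Precedes.trans {i j l : Fin n} (h : Precedes k deg i j) (h' : Precedes k deg j l) :
    Precedes k deg i l := by
  rcases h with h | ⟨rfl, -⟩
  exacts [of_lt_of_precedes h h', h']

namespace StdWord

/-- The empty word. -/
def nil : StdWord k deg := ⟨[], List.Pairwise.nil⟩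

/-- `i` can be prepended to the standard word `w`. -/
def CanCons (i : Fin n) (w : StdWord k deg) : Prop := ∀ j ∈ w.1, Precedes k deg i j

/-- Prepending an index to a standard word. -/
def cons (i : Fin n) (w : StdWord k deg) (h : CanCons i w) : StdWord k deg :=
  ⟨i :: w.1, List.pairwise_cons.2 ⟨h, w.2⟩⟩

/-- The length of a standard word. -/
def length (w : StdWord k deg) : ℕ := w.1.length

@[simp] theorem length_cons (i : Fin n) (w : StdWord k deg) (h : CanCons i w) :
    (cons i w h).length = w.length + 1 := rfl

theorem canCons_nil (i : Fin n) : CanCons i (nil : StdWord k deg) := by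
  simp [CanCons, nil]

theorem canCons_cons {i j : Fin n} {w : StdWord k deg} {h : CanCons j w} :
    CanCons i (cons j w h) ↔ Precedes k deg i j ∧ CanCons i w := by
  simp [CanCons, cons]

theorem canCons_cons_iff {i j : Fin n} {w : StdWord k deg} {h : CanCons j w} :
    CanCons i (cons j w h) ↔ Precedes k deg i j :=
  canCons_cons.trans ⟨And.left, fun h' => ⟨h', fun _ hl => h'.trans (h _ hl)⟩⟩

theorem CanCons.of_lt {i j : Fin n} (h : i < j) {w : StdWord k deg} (hw : CanCons j w) :
    CanCons i w := fun l hl => Precedes.of_lt_of_precedes h (hw l hl)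

@[elab_as_elim]
theorem cases_on {Q : StdWord k deg → Prop} (w : StdWord k deg) (nil : Q nil)
    (cons : ∀ j v h, Q (cons j v h)) : Q w := by
  obtain ⟨_ | ⟨j, l⟩, hw⟩ := w
  · exact nil
  · exact cons j ⟨l, (List.pairwise_cons.1 hw).2⟩ (List.pairwise_cons.1 hw).1

/-- The only obstructions to prepending are a descent and a fermionic repetition, one for each
rewriting rule. -/
theorem lt_or_eq_of_not_canCons {i j : Fin n} {w : StdWord k deg} {h : CanCons j w}
    (hi : ¬ CanCons i (cons j w h)) : j < i ∨ i = j ∧ IsFermionic k deg i := by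
  rw [canCons_cons_iff] at hi
  rcases lt_trichotomy i j with h | rfl | h
  · exact absurd (Or.inl h) hi
  · refine Or.inr ⟨rfl, ?_⟩
    by_contra h'
    exact hi (Or.inr ⟨rfl, h'⟩)
  · exact Or.inl h

theorem not_canCons_of_lt {i j : Fin n} {w : StdWord k deg} {h : CanCons j w} (hij : j < i) :
    ¬ CanCons i (cons j w h) := fun hi => (canCons_cons_iff.1 hi).le.not_gt hij

theorem not_canCons_self {i : Fin n} {w : StdWord k deg} {h : CanCons i w}
    (hi : IsFermionic k deg i) : ¬ CanCons i (cons i w h) := fun hc => by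
  rcases canCons_cons_iff.1 hc with h | ⟨-, h⟩
  exacts [h.false, h hi]

end StdWord

variable (k deg) in
/-- The free left `R`-module on the standard words. -/
abbrev StdModule : Type _ := StdWord k deg →₀ Poly k deg

end StandardWords

/-! ### The operators `y_i` on the standard module -/

section StdModule

variable {k : Type*} [Field k] {n : ℕ} {deg : Fin n → ℤ}

namespace StdModule

open StdWord

/-- The basis element of the standard module belonging to a standard word. -/
def mono (w : StdWord k deg) : StdModule k deg := Finsupp.single w 1

variable (k deg) in
/-- The action of `R` on the standard module. -/
def act : Poly k deg →ₐ[k] Module.End k (StdModule k deg) := Algebra.lsmul k k _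

@[simp] theorem act_apply (f : Poly k deg) (u : StdModule k deg) : act k deg f u = f • u := rfl

theorem hamiltonian_act_apply (Y : Fin n → Module.End k (StdModule k deg)) (f : Poly k deg)
    (u : StdModule k deg) :
    hamiltonian (act k deg) Y f u = ∑ r, Poly.psi r f • Y r u := by
  simp [hamiltonian_apply]

variable (P : DGPoissonStructure (Poly.grading k deg))

/-- The operator with values `b w` on the basis that satisfies
`Y (f u) = (-1)^{|x_i||f|} f Y(u) + {x_i, f} u`. -/
def skew (i : Fin n) (b : StdWord k deg → StdModule k deg) : Module.End k (StdModule k deg) :=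
  Finsupp.lsum k fun w =>
    (LinearMap.toSpanSingleton (Poly k deg) (StdModule k deg) (b w)).restrictScalars k ∘ₗ
      (Poly.twist i).toLinearMap + Finsupp.lsingle w ∘ₗ P.bracket (Poly.x k deg i)

theorem skew_single (i : Fin n) (b : StdWord k deg → StdModule k deg) (w : StdWord k deg)
    (f : Poly k deg) : skew P i b (Finsupp.single w f) =
      Poly.twist i f • b w + Finsupp.single w (P.bracket (Poly.x k deg i) f) := by
  simp [skew]

@[simp] theorem skew_mono (i : Fin n) (b : StdWord k deg → StdModule k deg)
    (w : StdWord k deg) : skew P i b (mono w) = b w := by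
  simp [mono, skew_single, P.bracket_one (Poly.x_mem i)]

theorem skew_smul (i : Fin n) (b : StdWord k deg → StdModule k deg) (f : Poly k deg)
    (u : StdModule k deg) : skew P i b (f • u) =
      Poly.twist i f • skew P i b u + P.bracket (Poly.x k deg i) f • u := by
  induction u using Finsupp.induction_linear with
  | zero => simp
  | add u v hu hv => simp only [smul_add, map_add, hu, hv]; abel
  | single w g =>
    rw [Finsupp.smul_single, skew_single, skew_single, smul_eq_mul, map_mul, P.bracket_x_mul,
      Finsupp.single_add, smul_add, Finsupp.smul_single, Finsupp.smul_single, mul_smul,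
      smul_eq_mul, smul_eq_mul]
    abel

/-- This holds whatever the values on the basis, so these may be chosen solely with the relations
among the `y_i` in view. -/
theorem isConnection_skew (b : Fin n → StdWord k deg → StdModule k deg) :
    IsConnection (act k deg) (fun i => skew P i (b i)) P := fun i j => by
  refine LinearMap.ext fun u => ?_
  simp only [Module.End.mul_apply, act_apply, skew_smul, LinearMap.add_apply,
    LinearMap.smul_apply, Poly.twist_of_mem i (Poly.x_mem j), smul_assoc]

theorem supported_induction {S : Set (StdWord k deg)} {Q : StdModule k deg → Prop}
    (zero : Q 0) (add : ∀ u v, Q u → Q v → Q (u + v)) (smul : ∀ (f : Poly k deg) u, Q u → Q (f • u))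
    (mono : ∀ w ∈ S, Q (mono w)) {u : StdModule k deg}
    (hu : u ∈ Finsupp.supported (Poly k deg) (Poly k deg) S) : Q u := by
  rw [Finsupp.supported_eq_span_single] at hu
  induction hu using Submodule.span_induction with
  | mem u h => obtain ⟨w, hw, rfl⟩ := h; exact mono w hw
  | zero => exact zero
  | add u v _ _ hu hv => exact add u v hu hv
  | smul f u _ hu => exact smul f u hu

theorem mono_mem {S : Set (StdWord k deg)} {w : StdWord k deg} (hw : w ∈ S) :
    mono w ∈ Finsupp.supported (Poly k deg) (Poly k deg) S :=
  Finsupp.single_mem_supported _ _ hw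

/-- The term `{x_i, f} u` keeps the words of `u`, whence the condition `S ⊆ S'`. -/
theorem skew_mem {i : Fin n} {b : StdWord k deg → StdModule k deg} {S S' : Set (StdWord k deg)}
    (hS : S ⊆ S') (hb : ∀ w ∈ S, b w ∈ Finsupp.supported (Poly k deg) (Poly k deg) S')
    {u : StdModule k deg} (hu : u ∈ Finsupp.supported (Poly k deg) (Poly k deg) S) :
    skew P i b u ∈ Finsupp.supported (Poly k deg) (Poly k deg) S' := by
  suffices h : u ∈ Finsupp.supported (Poly k deg) (Poly k deg) S' ∧
      skew P i b u ∈ Finsupp.supported (Poly k deg) (Poly k deg) S' from h.2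
  refine supported_induction
    (Q := fun u => u ∈ Finsupp.supported (Poly k deg) (Poly k deg) S' ∧
      skew P i b u ∈ Finsupp.supported (Poly k deg) (Poly k deg) S') ?_ ?_ ?_ ?_ hu
  · simp
  · intro u v hu hv
    rw [map_add]
    exact ⟨Submodule.add_mem _ hu.1 hv.1, Submodule.add_mem _ hu.2 hv.2⟩
  · intro f u hu
    rw [skew_smul]
    exact ⟨Submodule.smul_mem _ _ hu.1,
      Submodule.add_mem _ (Submodule.smul_mem _ _ hu.2) (Submodule.smul_mem _ _ hu.1)⟩
  · intro w hw
    rw [skew_mono]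
    exact ⟨mono_mem (hS hw), hb w hw⟩

theorem skew_congr {i : Fin n} {b b' : StdWord k deg → StdModule k deg}
    {S : Set (StdWord k deg)} (hb : ∀ w ∈ S, b w = b' w)
    {u : StdModule k deg} (hu : u ∈ Finsupp.supported (Poly k deg) (Poly k deg) S) :
    skew P i b u = skew P i b' u := by
  refine supported_induction (Q := fun u => skew P i b u = skew P i b' u) ?_ ?_ ?_ ?_ hu
  · simp
  · intro u v hu hv
    rw [map_add, map_add, hu, hv]
  · intro f u hu
    rw [skew_smul, skew_smul, hu]
  · intro w hw
    rw [skew_mono, skew_mono, hb w hw]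

theorem hamiltonian_act_mem {Y : Fin n → Module.End k (StdModule k deg)} {u : StdModule k deg}
    {N : Submodule (Poly k deg) (StdModule k deg)} (h : ∀ r, Y r u ∈ N) (f : Poly k deg) :
    hamiltonian (act k deg) Y f u ∈ N := by
  rw [hamiltonian_act_apply]
  exact Submodule.sum_mem _ fun r _ => Submodule.smul_mem _ _ (h r)

theorem hamiltonian_act_congr {Y Y' : Fin n → Module.End k (StdModule k deg)}
    {u : StdModule k deg} (h : ∀ r, Y r u = Y' r u) (f : Poly k deg) :
    hamiltonian (act k deg) Y f u = hamiltonian (act k deg) Y' f u := by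
  simp only [hamiltonian_act_apply, h]

open Classical in
/-- The value of `y_i` on a basis element, computed from approximations `Y` to the operators
`y_r` by means of the relations. -/
def step (Y : Fin n → Module.End k (StdModule k deg)) (i : Fin n) (w : StdWord k deg) :
    StdModule k deg :=
  if h : CanCons i w then mono (cons i w h) else
    match w with
    -- Never reached: every index can be prepended to the empty word.
    | ⟨[], _⟩ => 0
    | ⟨j :: l, hw⟩ =>
      -- Here `i` is fermionic, so `2` is invertible and the relation for `(i, i)` gives `y_i² = ½
      -- h({x_i, x_i})`. In the other branch `j < i`.
      if i = j then
        (2⁻¹ : k) • hamiltonian (act k deg) Y (P.bracket (Poly.x k deg i) (Poly.x k deg i))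
          (mono ⟨l, (List.pairwise_cons.1 hw).2⟩)
      else
        (-1 : k) ^ (deg i * deg j) • Y j (Y i (mono ⟨l, (List.pairwise_cons.1 hw).2⟩)) +
          hamiltonian (act k deg) Y (P.bracket (Poly.x k deg i) (Poly.x k deg j))
            (mono ⟨l, (List.pairwise_cons.1 hw).2⟩)

variable {P}

theorem step_of_canCons {Y : Fin n → Module.End k (StdModule k deg)} {i : Fin n}
    {w : StdWord k deg} (h : CanCons i w) : step P Y i w = mono (cons i w h) := by
  rw [step, dif_pos h]

theorem step_cons_self {Y : Fin n → Module.End k (StdModule k deg)} {i : Fin n}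
    {w : StdWord k deg} (h : CanCons i w) (hi : IsFermionic k deg i) :
    step P Y i (cons i w h) = (2⁻¹ : k) • hamiltonian (act k deg) Y
      (P.bracket (Poly.x k deg i) (Poly.x k deg i)) (mono w) := by
  rw [step, dif_neg (not_canCons_self hi)]
  exact if_pos rfl

theorem step_cons_of_lt {Y : Fin n → Module.End k (StdModule k deg)} {i j : Fin n}
    {w : StdWord k deg} (h : CanCons j w) (hij : j < i) :
    step P Y i (cons j w h) = (-1 : k) ^ (deg i * deg j) • Y j (Y i (mono w)) +
      hamiltonian (act k deg) Y (P.bracket (Poly.x k deg i) (Poly.x k deg j)) (mono w) := by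
  rw [step, dif_neg (not_canCons_of_lt hij)]
  exact if_neg hij.ne'

open Classical in
variable (P) in
/-- Successive approximations to the operators `y_i` on the standard module; the `q`-th one is
correct on words of length at most `q`. -/
def approx : ℕ → Fin n → Module.End k (StdModule k deg)
  | 0, i => skew P i fun w => if h : CanCons i w then mono (cons i w h) else 0
  | q + 1, i => skew P i (step P (approx q) i)

theorem approx_mono_of_canCons (q : ℕ) {i : Fin n} {w : StdWord k deg} (h : CanCons i w) :
    approx P q i (mono w) = mono (cons i w h) := by
  cases q with
  | zero => rw [approx, skew_mono, dif_pos h]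
  | succ q => rw [approx, skew_mono, step_of_canCons h]

/-- The words that may occur in `y_i w`. -/
def growth (i : Fin n) (w : StdWord k deg) : Set (StdWord k deg) :=
  {v | v.length ≤ w.length ∨
    v.length = w.length + 1 ∧ ∀ j, j < i → CanCons j w → CanCons j v}

theorem growth_subset (i : Fin n) (w : StdWord k deg) :
    growth i w ⊆ {v | v.length ≤ w.length + 1} := by
  rintro v (h | ⟨h, -⟩)
  · exact h.trans (Nat.le_succ _)
  · exact h.le

theorem exists_approx_eq_skew (q : ℕ) (i : Fin n) : ∃ b, approx P q i = skew P i b := by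
  cases q
  exacts [⟨_, rfl⟩, ⟨_, rfl⟩]

/-- This bound makes the recursion work. In `y_i (y_j w) = ± y_j (y_i w) + …` the vector `y_i w` may
contain words as long as `y_j w`, but these still accept the letter `j < i`, so on them `y_j` merely
prepends. -/
theorem approx_mono_mem (q : ℕ) (i : Fin n) (w : StdWord k deg) :
    approx P q i (mono w) ∈ Finsupp.supported (Poly k deg) (Poly k deg) (growth i w) := by
  induction q generalizing i w with
  | zero =>
    by_cases h : CanCons i w
    · rw [approx_mono_of_canCons 0 h]
      exact mono_mem (Or.inr ⟨rfl, fun j hj hjw => canCons_cons.2 ⟨Or.inl hj, hjw⟩⟩)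
    · rw [approx, skew_mono, dif_neg h]
      exact Submodule.zero_mem _
  | succ q ih =>
    by_cases h : CanCons i w
    · rw [approx_mono_of_canCons _ h]
      exact mono_mem (Or.inr ⟨rfl, fun j hj hjw => canCons_cons.2 ⟨Or.inl hj, hjw⟩⟩)
    rw [approx, skew_mono]
    induction w using StdWord.cases_on with
    | nil => exact absurd (canCons_nil i) h
    | cons j w hj =>
      have hH (f : Poly k deg) : hamiltonian (act k deg) (approx P q) f (mono w) ∈
          Finsupp.supported (Poly k deg) (Poly k deg) (growth i (cons j w hj)) :=
        hamiltonian_act_mem (fun r => Finsupp.supported_mono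
          ((growth_subset r w).trans fun v hv => Or.inl hv) (ih r w)) f
      rcases lt_or_eq_of_not_canCons h with hij | ⟨rfl, hi⟩
      · rw [step_cons_of_lt hj hij]
        refine Submodule.add_mem _ ?_ (hH _)
        refine Submodule.smul_of_tower_mem _ _ ?_
        obtain ⟨b, hb⟩ := exists_approx_eq_skew (P := P) q j
        rw [hb]
        refine skew_mem P ?_ ?_ (ih i w)
        · exact fun v hv => Or.inl (growth_subset i w hv)
        · intro v hv
          rw [← skew_mono P j b, ← hb]
          -- On words no longer than `w` the crude length bound for `y_j` is enough; on longer ones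
          -- `y_j` prepends.
          rcases hv with hv | ⟨hv, hv'⟩
          · refine Finsupp.supported_mono ?_ (ih j v)
            exact fun u hu => Or.inl ((growth_subset j v hu).trans (Nat.succ_le_succ hv))
          · rw [approx_mono_of_canCons q (hv' j hij hj)]
            refine mono_mem (Or.inr ⟨by simp [hv], fun l hl hlw => ?_⟩)
            rw [canCons_cons] at hlw ⊢
            exact ⟨hlw.1, hv' l hl hlw.2⟩
      · rw [step_cons_self hj hi]
        exact Submodule.smul_of_tower_mem _ _ (hH _)

theorem approx_congr {q q' : ℕ} {i : Fin n} {S : Set (StdWord k deg)}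
    (h : ∀ w ∈ S, approx P q i (mono w) = approx P q' i (mono w)) {u : StdModule k deg}
    (hu : u ∈ Finsupp.supported (Poly k deg) (Poly k deg) S) :
    approx P q i u = approx P q' i u := by
  obtain ⟨b, hb⟩ := exists_approx_eq_skew (P := P) q i
  obtain ⟨b', hb'⟩ := exists_approx_eq_skew (P := P) q' i
  rw [hb, hb'] at h ⊢
  exact skew_congr P (fun w hw => by simpa using h w hw) hu

/-- On `y_j w` the recursion calls the previous stage at `w`, at words no longer than `w`, and at
words where prepending decides; all of these have stabilised. -/
theorem approx_succ_mono (q : ℕ) (i : Fin n) (w : StdWord k deg) (hw : w.length ≤ q) :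
    approx P (q + 1) i (mono w) = approx P q i (mono w) := by
  induction q generalizing i w with
  | zero =>
    induction w using StdWord.cases_on with
    | nil => rw [approx_mono_of_canCons _ (canCons_nil i), approx_mono_of_canCons _ (canCons_nil i)]
    | cons j w hj => simp at hw
  | succ q ih =>
    by_cases h : CanCons i w
    · rw [approx_mono_of_canCons _ h, approx_mono_of_canCons _ h]
    rw [approx, skew_mono, approx, skew_mono]
    induction w using StdWord.cases_on with
    | nil => exact absurd (canCons_nil i) h
    | cons j w hj =>
      have hw' : w.length ≤ q := Nat.succ_le_succ_iff.1 hw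
      have hH (f : Poly k deg) : hamiltonian (act k deg) (approx P (q + 1)) f (mono w) =
          hamiltonian (act k deg) (approx P q) f (mono w) :=
        hamiltonian_act_congr (fun r => ih r w hw') f
      rcases lt_or_eq_of_not_canCons h with hij | ⟨rfl, hi⟩
      · rw [step_cons_of_lt hj hij, step_cons_of_lt hj hij, hH, ih i w hw']
        congr 2
        refine approx_congr ?_ (approx_mono_mem q i w)
        rintro v (hv | ⟨-, hv⟩)
        · exact ih j v (hv.trans hw')
        · rw [approx_mono_of_canCons _ (hv j hij hj), approx_mono_of_canCons _ (hv j hij hj)]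
      · rw [step_cons_self hj hi, step_cons_self hj hi, hH]

theorem approx_mono_eq {q : ℕ} (i : Fin n) {w : StdWord k deg} (hw : w.length ≤ q) :
    approx P q i (mono w) = approx P w.length i (mono w) := by
  induction q, hw using Nat.le_induction with
  | base => rfl
  | succ q hq ih => rw [approx_succ_mono q i w hq, ih]

variable (P) in
/-- The operators by which the generators `y_i` act on the standard module. -/
def yAct (i : Fin n) : Module.End k (StdModule k deg) :=
  skew P i fun w => approx P w.length i (mono w)

theorem yAct_mono {q : ℕ} (i : Fin n) {w : StdWord k deg} (hw : w.length ≤ q) :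
    yAct P i (mono w) = approx P q i (mono w) := by
  rw [yAct, skew_mono, approx_mono_eq i hw]

theorem yAct_mono_mem (i : Fin n) (w : StdWord k deg) :
    yAct P i (mono w) ∈ Finsupp.supported (Poly k deg) (Poly k deg) (growth i w) := by
  rw [yAct_mono i le_rfl]
  exact approx_mono_mem _ i w

theorem yAct_mono_of_canCons {i : Fin n} {w : StdWord k deg} (h : CanCons i w) :
    yAct P i (mono w) = mono (cons i w h) := by
  rw [yAct_mono i le_rfl, approx_mono_of_canCons _ h]

theorem yAct_mono_cons_self {i : Fin n} {w : StdWord k deg} (h : CanCons i w)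
    (hi : IsFermionic k deg i) :
    yAct P i (mono (cons i w h)) = (2⁻¹ : k) • hamiltonian (act k deg) (yAct P)
      (P.bracket (Poly.x k deg i) (Poly.x k deg i)) (mono w) := by
  rw [yAct_mono i le_rfl, length_cons, approx, skew_mono, step_cons_self h hi,
    hamiltonian_act_congr fun r => (yAct_mono r le_rfl).symm]

/-- The rewriting rule for a descent, now with the final operators on both sides. -/
theorem yAct_mono_cons_of_lt {i j : Fin n} {w : StdWord k deg} (h : CanCons j w) (hij : j < i) :
    yAct P i (mono (cons j w h)) =
      (-1 : k) ^ (deg i * deg j) • yAct P j (yAct P i (mono w)) +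
      hamiltonian (act k deg) (yAct P)
        (P.bracket (Poly.x k deg i) (Poly.x k deg j)) (mono w) := by
  rw [yAct_mono i le_rfl, length_cons, approx, skew_mono, step_cons_of_lt h hij,
    hamiltonian_act_congr fun r => (yAct_mono r le_rfl).symm, yAct_mono i le_rfl]
  congr 2
  obtain ⟨b, hb⟩ := exists_approx_eq_skew (P := P) w.length j
  rw [hb, yAct]
  refine skew_congr P ?_ (approx_mono_mem w.length i w)
  intro v hv
  rw [← skew_mono P j b, ← hb]
  -- The stage `w.length` already gives the final value of `y_j` on every word of `y_i w`: by
  -- length, or because `j` is prepended.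
  rcases hv with hv | ⟨-, hv⟩
  · exact approx_mono_eq j hv
  · rw [approx_mono_of_canCons _ (hv j hij h), approx_mono_of_canCons _ (hv j hij h)]

theorem isConnection_yAct : IsConnection (act k deg) (yAct P) P := isConnection_skew P _

theorem yAct_smul (i : Fin n) (f : Poly k deg) (u : StdModule k deg) : yAct P i (f • u) =
    Poly.twist i f • yAct P i u + P.bracket (Poly.x k deg i) f • u := skew_smul P i _ f u

theorem yAct_mem_of_length {i : Fin n} {q : ℕ} {u : StdModule k deg}
    (hu : u ∈ Finsupp.supported (Poly k deg) (Poly k deg) {w | w.length < q}) :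
    yAct P i u ∈ Finsupp.supported (Poly k deg) (Poly k deg) {w | w.length < q + 1} := by
  refine skew_mem P (fun w hw => Nat.lt_succ_of_lt hw) (fun w hw => ?_) hu
  rw [← yAct_mono i le_rfl]
  refine Finsupp.supported_mono ?_ (yAct_mono_mem i w)
  exact (growth_subset i w).trans fun v hv => Nat.lt_succ_of_le (le_trans hv hw)

end StdModule

end StdModule

/-! ### Flatness: the relations among the `y_i` hold on the standard module -/

section Flatness

variable {k : Type*} [Field k] {n : ℕ} {deg : Fin n → ℤ}
  {P : DGPoissonStructure (Poly.grading k deg)}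

theorem neg_one_zpow_of_not_isFermionic {i : Fin n} (hi : ¬ IsFermionic k deg i) :
    (-1 : k) ^ (deg i * deg i) = 1 := by
  by_cases h : Odd (deg i)
  · have h2 : (2 : k) = 0 := by
      by_contra h'
      exact hi ⟨h, h'⟩
    rw [(h.mul h).neg_one_zpow]
    linear_combination -h2
  · exact ((Int.not_odd_iff_even.1 h).mul_left _).neg_one_zpow

theorem IsFermionic.neg_one_zpow {i : Fin n} (hi : IsFermionic k deg i) :
    (-1 : k) ^ (deg i * deg i) = -1 := (hi.1.mul hi.1).neg_one_zpow

namespace DGPoissonStructure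

/-- If `2 ≠ 0`, then `x_i` is even and antisymmetry gives `2 {x_i, x_i} = 0`; characteristic 2 is
covered by the assumption. -/
theorem bracket_self (h2 : (2 : k) = 0 → ∀ i, P.bracket (Poly.x k deg i) (Poly.x k deg i) = 0)
    {i : Fin n} (hi : ¬ IsFermionic k deg i) :
    P.bracket (Poly.x k deg i) (Poly.x k deg i) = 0 := by
  by_cases h : (2 : k) = 0
  · exact h2 h i
  have e := P.antisymm _ _ _ (Poly.x_mem i) _ (Poly.x_mem i)
  rw [neg_one_zpow_of_not_isFermionic hi, one_smul, eq_neg_iff_add_eq_zero, ← two_smul k] at e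
  exact (smul_eq_zero.1 e).resolve_left h

/-- For odd `x` the Jacobi identity for `(x, x, x)` reads `3 {x, {x, x}} = 0`; only characteristic 3
needs the assumption. -/
theorem bracket_bracket_self
    (h3 : (3 : k) = 0 → ∀ i, Odd (deg i) → P.bracket (Poly.x k deg i)
      (P.bracket (Poly.x k deg i) (Poly.x k deg i)) = 0)
    {i : Fin n} (hi : IsFermionic k deg i) :
    P.bracket (Poly.x k deg i) (P.bracket (Poly.x k deg i) (Poly.x k deg i)) = 0 := by
  by_cases h : (3 : k) = 0
  · exact h3 h i hi.1
  have hx := Poly.x_mem (k := k) (deg := deg) i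
  have e := P.jacobi _ _ _ _ hx _ hx _ hx
  rw [P.antisymm _ _ _ (P.bracket_mem _ _ _ hx _ hx) _ hx, add_mul, neg_one_zpow_add,
    hi.neg_one_zpow] at e
  have e' : (3 : k) • P.bracket (Poly.x k deg i)
      (P.bracket (Poly.x k deg i) (Poly.x k deg i)) = 0 := by
    linear_combination (norm := module) e
  exact (smul_eq_zero.1 e').resolve_left h

end DGPoissonStructure

namespace StdModule

open StdWord

variable (P) in
/-- The defect of the relation between `y_i` and `y_j` on the standard module. -/
abbrev curv (i j : Fin n) : Module.End k (StdModule k deg) :=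
  curvature (act k deg) (yAct P) P (deg i) (deg j) (Poly.x k deg i) (Poly.x k deg j)

theorem curv_apply (i j : Fin n) (u : StdModule k deg) :
    curv P i j u = yAct P i (yAct P j u) - (-1 : k) ^ (deg i * deg j) •
      yAct P j (yAct P i u) - hamiltonian (act k deg) (yAct P)
        (P.bracket (Poly.x k deg i) (Poly.x k deg j)) u := by
  simp [curv, curvature, hamiltonian_x]

theorem curv_eq_zero_symm {i j : Fin n} {u : StdModule k deg} (h : curv P i j u = 0) :
    curv P j i u = 0 := by
  rw [curv, curvature_symm (Poly.x_mem j) (Poly.x_mem i), LinearMap.neg_apply,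
    LinearMap.smul_apply, h, smul_zero, neg_zero]

theorem curv_smul_eq_zero {i j : Fin n} {u : StdModule k deg} (h : curv P i j u = 0)
    (f : Poly k deg) : curv P i j (f • u) = 0 := by
  induction f using DirectSum.Decomposition.inductionOn (Poly.grading k deg) with
  | zero => simp
  | homogeneous f =>
    have e := isConnection_yAct.curvature_mul_apply (P := P) (Poly.x_mem i) (Poly.x_mem j) f.2
    have e' := DFunLike.congr_fun e u
    rw [Module.End.mul_apply, LinearMap.smul_apply, Module.End.mul_apply, h, map_zero,
      smul_zero] at e'
    exact e'
  | add f g hf hg => rw [add_smul, map_add, hf, hg, add_zero]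

theorem curv_eq_zero_of_mem {i j : Fin n} {S : Set (StdWord k deg)}
    (h : ∀ w ∈ S, curv P i j (mono w) = 0) {u : StdModule k deg}
    (hu : u ∈ Finsupp.supported (Poly k deg) (Poly k deg) S) : curv P i j u = 0 :=
  supported_induction (Q := fun u => curv P i j u = 0) (map_zero _)
    (fun u v hu hv => by rw [map_add, hu, hv, add_zero])
    (fun f u hu => curv_smul_eq_zero hu f) h hu

/-- The relations hold on the vector `u`. -/
def IsFlat (P : DGPoissonStructure (Poly.grading k deg)) (u : StdModule k deg) : Prop :=
  ∀ i j, curv P i j u = 0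

/-- The operators killing `u` form a left ideal, so `curvature_mem` extends the relations from
generators to all of `R` at the single vector `u`. This pointwise form is what an induction on words
requires. -/
theorem IsFlat.hamiltonian_comm {u : StdModule k deg} (hu : IsFlat P u) {p q : ℤ}
    {a b : Poly k deg} (ha : a ∈ Poly.grading k deg p) (hb : b ∈ Poly.grading k deg q) :
    hamiltonian (act k deg) (yAct P) a (hamiltonian (act k deg) (yAct P) b u) =
      (-1 : k) ^ (p * q) • hamiltonian (act k deg) (yAct P) b
        (hamiltonian (act k deg) (yAct P) a u) +
      hamiltonian (act k deg) (yAct P) (P.bracket a b) u := by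
  have h := isConnection_yAct.curvature_mem (LinearMap.ker
    (LinearMap.toSpanSingleton (Module.End k (StdModule k deg)) (StdModule k deg) u)) hu ha hb
  have h' : curvature (act k deg) (yAct P) P p q a b u = 0 := h
  rw [curvature, LinearMap.sub_apply, LinearMap.sub_apply, LinearMap.smul_apply, sub_sub,
    sub_eq_zero] at h'
  exact h'

/-- The Jacobi identity propagates the relations from `u` to `y_l u`. -/
theorem IsFlat.curv_yAct {u : StdModule k deg} (hu : IsFlat P u) {i j l : Fin n}
    (h1 : curv P i l (yAct P j u) = 0) (h2 : curv P j l (yAct P i u) = 0) :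
    curv P i j (yAct P l u) = 0 := by
  have hx (i : Fin n) := Poly.x_mem (k := k) (deg := deg) i
  have hb (i j : Fin n) := P.bracket_mem _ _ _ (hx i) _ (hx j)
  have e1 := hu.hamiltonian_comm (hx i) (hx j)
  have e2 := hu.hamiltonian_comm (hx i) (hx l)
  have e3 := hu.hamiltonian_comm (hx j) (hx l)
  have e4 := hu.hamiltonian_comm (hx i) (hb j l)
  have e5 := hu.hamiltonian_comm (hx j) (hb i l)
  have e6 := hu.hamiltonian_comm (hb i j) (hx l)
  have hJ := congrArg (fun f => hamiltonian (act k deg) (yAct P) f u)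
    (P.jacobi _ _ _ _ (hx i) _ (hx j) _ (hx l))
  simp only [map_add, map_smul, LinearMap.add_apply, LinearMap.smul_apply] at hJ
  rw [curv_apply, sub_sub, sub_eq_zero] at h1 h2
  rw [curv_apply]
  simp only [hamiltonian_x] at e1 e2 e3 e4 e5 e6
  -- Bring `y_l` to the far left in every term, past `y_i` and `y_j` by `h1` and `h2`; what is left
  -- over is `hJ`, the image of the Jacobi identity.
  rw [e2, e3, e6]
  simp only [map_add, map_smul, h1, h2, e1, e4, e5, hJ]
  simp only [smul_add, smul_smul, mul_add, add_mul, neg_one_zpow_add, mul_comm (deg j) (deg i)]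
  rcases neg_one_zpow_cases (k := k) (deg i * deg j) with h1 | h1 <;>
  rcases neg_one_zpow_cases (k := k) (deg i * deg l) with h2 | h2 <;>
  rcases neg_one_zpow_cases (k := k) (deg j * deg l) with h3 | h3 <;>
  simp only [h1, h2, h3, one_smul, neg_smul, mul_one, mul_neg, neg_neg] <;> abel

/-- For `l = i` the argument of `curv_yAct` would be circular, as one of its hypotheses is the goal.
Instead `y_j` is applied to `2 y_i² u = H({x_i, x_i}) u` and compared with the same relation at `y_j
u`; this gives twice the claim, and `2 ≠ 0`. -/
theorem IsFlat.curv_yAct_right {u : StdModule k deg} (hu : IsFlat P u) {i j : Fin n}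
    (hi : IsFermionic k deg i) (h : curv P i i (yAct P j u) = 0) :
    curv P j i (yAct P i u) = 0 := by
  have hx (i : Fin n) := Poly.x_mem (k := k) (deg := deg) i
  have hb (i j : Fin n) := P.bracket_mem _ _ _ (hx i) _ (hx j)
  have e1 := congrArg (yAct P j) (hu.hamiltonian_comm (hx i) (hx i))
  have e2 := hu.hamiltonian_comm (hx j) (hx i)
  have e3 := hu.hamiltonian_comm (hx j) (hb i i)
  have e4 := hu.hamiltonian_comm (hx i) (hb j i)
  have hJ := P.jacobi _ _ _ _ (hx j) _ (hx i) _ (hx i)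
  rw [P.antisymm _ _ _ (hb j i) _ (hx i)] at hJ
  have hJ' := congrArg (fun f => hamiltonian (act k deg) (yAct P) f u) hJ
  simp only [map_add, map_smul, map_neg, LinearMap.add_apply, LinearMap.smul_apply,
    LinearMap.neg_apply] at hJ'
  rw [curv_apply, sub_sub, sub_eq_zero] at h
  simp only [hamiltonian_x] at e1 e2 e3 e4
  simp only [map_add, map_smul] at e1
  refine (smul_eq_zero.1 (?_ : (2 : k) • curv P j i (yAct P i u) = 0)).resolve_left hi.2
  rw [curv_apply, e2, map_add, map_smul, e4]
  rw [e3, hJ'] at e1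
  simp only [mul_add, add_mul, neg_one_zpow_add, hi.neg_one_zpow, mul_comm (deg i) (deg j)] at *
  rcases neg_one_zpow_cases (k := k) (deg j * deg i) with h1 | h1 <;> rw [h1] at e1 ⊢ <;>
    linear_combination (norm := module) e1 - h

/-- Apply `y_i` to `2 y_i² u = H({x_i, x_i}) u`: the obstruction to moving `y_i` past `H` is
`H({x_i, {x_i, x_i}}) u`. This is where the condition in characteristic 3 enters. -/
theorem IsFlat.curv_yAct_self {u : StdModule k deg} (hu : IsFlat P u) {i : Fin n}
    (hi : IsFermionic k deg i)
    (h : P.bracket (Poly.x k deg i) (P.bracket (Poly.x k deg i) (Poly.x k deg i)) = 0) :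
    curv P i i (yAct P i u) = 0 := by
  have hx (i : Fin n) := Poly.x_mem (k := k) (deg := deg) i
  have e1 := congrArg (yAct P i) (hu.hamiltonian_comm (hx i) (hx i))
  have e2 := hu.hamiltonian_comm (hx i) (P.bracket_mem _ _ _ (hx i) _ (hx i))
  simp only [hamiltonian_x] at e1 e2
  rw [map_add, map_smul, e2, h, map_zero, LinearMap.zero_apply, mul_add, neg_one_zpow_add,
    hi.neg_one_zpow] at e1
  rw [curv_apply, hi.neg_one_zpow]
  linear_combination (norm := module) e1

/-- Here `y_j w` is a single word, and `y_i` was defined on it so as to satisfy the relation. For `i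
< j` the roles are exchanged, since `i` can then be prepended to `w` as well. -/
theorem curv_mono_of_canCons
    (h2 : (2 : k) = 0 → ∀ i, P.bracket (Poly.x k deg i) (Poly.x k deg i) = 0)
    (i : Fin n) {j : Fin n} {w : StdWord k deg} (hj : CanCons j w) :
    curv P i j (mono w) = 0 := by
  rcases lt_trichotomy i j with h | rfl | h
  · apply curv_eq_zero_symm
    rw [curv_apply, yAct_mono_of_canCons (CanCons.of_lt h hj), yAct_mono_cons_of_lt _ h]
    abel
  · rw [curv_apply]
    by_cases hi : IsFermionic k deg i
    · rw [yAct_mono_of_canCons hj, yAct_mono_cons_self hj hi, hi.neg_one_zpow, neg_smul, one_smul,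
        sub_neg_eq_add, ← add_smul, ← two_mul, mul_inv_cancel₀ hi.2, one_smul, sub_self]
    · rw [P.bracket_self h2 hi, neg_one_zpow_of_not_isFermionic hi]
      simp
  · rw [curv_apply, yAct_mono_of_canCons hj, yAct_mono_cons_of_lt _ h]
    abel

theorem isFlat_mono
    (h2 : (2 : k) = 0 → ∀ i, P.bracket (Poly.x k deg i) (Poly.x k deg i) = 0)
    (h3 : (3 : k) = 0 → ∀ i, Odd (deg i) → P.bracket (Poly.x k deg i)
      (P.bracket (Poly.x k deg i) (Poly.x k deg i)) = 0)
    (w : StdWord k deg) : IsFlat P (mono w) := by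
  induction hq : w.length using Nat.strong_induction_on generalizing w with
  | _ q ih =>
    intro i j
    by_cases hj : CanCons j w
    · exact curv_mono_of_canCons h2 i hj
    by_cases hi : CanCons i w
    · exact curv_eq_zero_symm (curv_mono_of_canCons h2 j hi)
    induction w using StdWord.cases_on with
    | nil => exact absurd (canCons_nil i) hi
    | cons l w hl =>
      rw [length_cons] at hq
      have hw : IsFlat P (mono w) := ih w.length (by omega) w rfl
      -- Each word of `y_s w` is shorter than the word under consideration, or still accepts `l`.
      have key (r s : Fin n) (hs : l < s) : curv P r l (yAct P s (mono w)) = 0 := by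
        refine curv_eq_zero_of_mem ?_ (yAct_mono_mem s w)
        rintro v (hv | ⟨-, hv⟩)
        · exact ih v.length (by omega) v rfl r l
        · exact curv_mono_of_canCons h2 r (hv l hs hl)
      rw [← yAct_mono_of_canCons hl]
      -- Each of `i`, `j` exceeds `l` or is a fermionic repetition of it; the four cases use the
      -- three propagation lemmas.
      rcases lt_or_eq_of_not_canCons hi with hi' | ⟨rfl, hi'⟩ <;>
      rcases lt_or_eq_of_not_canCons hj with hj' | ⟨rfl, hj'⟩
      · exact hw.curv_yAct (key i j hj') (key j i hi')
      · exact hw.curv_yAct_right hj' (key j i hi')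
      · exact curv_eq_zero_symm (hw.curv_yAct_right hi' (key i j hj'))
      · exact hw.curv_yAct_self hj' (P.bracket_bracket_self h3 hj')

theorem isFlat
    (h2 : (2 : k) = 0 → ∀ i, P.bracket (Poly.x k deg i) (Poly.x k deg i) = 0)
    (h3 : (3 : k) = 0 → ∀ i, Odd (deg i) → P.bracket (Poly.x k deg i)
      (P.bracket (Poly.x k deg i) (Poly.x k deg i)) = 0)
    (u : StdModule k deg) : IsFlat P u := fun i j =>
  curv_eq_zero_of_mem (S := Set.univ) (fun w _ => isFlat_mono h2 h3 w i j) (by simp)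

end StdModule

end Flatness

/-! ### The standard monomials as a left and as a right basis of `R^e` -/

section Basis

variable {k : Type*} [Field k] {n : ℕ} {deg : Fin n → ℤ}

open StdModule StdWord

/-- The automorphism `a ↦ (-1)^{|w||a|} a`, where `|w|` is the degree of the word `w`. -/
def Poly.twistWord : List (Fin n) → Poly k deg →ₐ[k] Poly k deg
  | [] => AlgHom.id k _
  | i :: l => (Poly.twist i).comp (twistWord l)

theorem Poly.twistWord_bijective (l : List (Fin n)) :
    Function.Bijective (twistWord (k := k) (deg := deg) l) := by
  induction l with
  | nil => exact Function.bijective_id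
  | cons i l ih => exact (Function.Involutive.bijective (Poly.twist_twist i)).comp ih

/-- The product of the `g i` along a standard word. -/
def StdWord.eval {A : Type*} [Monoid A] (g : Fin n → A) (w : StdWord k deg) : A := (w.1.map g).prod

theorem StdWord.eval_nil {A : Type*} [Monoid A] (g : Fin n → A) :
    (nil : StdWord k deg).eval g = 1 := rfl

theorem StdWord.eval_cons {A : Type*} [Monoid A] (g : Fin n → A) {i : Fin n} {w : StdWord k deg}
    (h : CanCons i w) : (cons i w h).eval g = g i * w.eval g := rfl

theorem StdModule.mono_apply_self (w : StdWord k deg) : mono w w = 1 := Finsupp.single_eq_same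

theorem StdModule.mono_apply_of_ne {v w : StdWord k deg} (h : v ≠ w) : mono v w = 0 :=
  Finsupp.single_eq_of_ne h.symm

namespace Env

variable (P : DGPoissonStructure (Poly.grading k deg))

theorem y_mul_m (i : Fin n) (f : Poly k deg) :
    y P i * m P f = m P (Poly.twist i f) * y P i + m P (P.bracket (Poly.x k deg i) f) := by
  have e : LinearMap.mulLeft k (y P i) ∘ₗ (m P).toLinearMap =
      LinearMap.mulRight k (y P i) ∘ₗ (m P).toLinearMap ∘ₗ (Poly.twist i).toLinearMap +
      (m P).toLinearMap ∘ₗ P.bracket (Poly.x k deg i) := Poly.linearMap_ext fun p a ha => by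
    simp [(isConnection P).mul_apply i ha, Poly.twist_of_mem i ha]
  exact DFunLike.congr_fun e f

/-- The `R`-linear map from the standard module to `R^e`. -/
def ofStd : StdModule k deg →ₗ[Poly k deg] Env P :=
  Finsupp.linearCombination (Poly k deg) fun w => w.eval (y P)

variable {P}

theorem ofStd_mono (w : StdWord k deg) : ofStd P (mono w) = w.eval (y P) := by
  simp [ofStd, mono]

theorem ofStd_smul (f : Poly k deg) (u : StdModule k deg) :
    ofStd P (f • u) = m P f * ofStd P u := map_smul _ _ _

instance : IsScalarTower k (Poly k deg) (Env P) :=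
  ⟨fun c f u => by rw [smul_def, smul_def, map_smul, smul_mul_assoc]⟩

instance : IsScalarTower k (Poly k deg)ᵐᵒᵖ (Env P) :=
  ⟨fun c f u => by
    obtain ⟨f, rfl⟩ := MulOpposite.op_surjective f
    rw [← MulOpposite.op_smul, op_smul_def, op_smul_def, map_smul, mul_smul_comm]⟩

theorem ofStd_smul_base (c : k) (u : StdModule k deg) : ofStd P (c • u) = c • ofStd P u := by
  rw [← algebraMap_smul (Poly k deg) c u, map_smul, algebraMap_smul]

theorem ofStd_yAct_of_mem {i : Fin n} {S : Set (StdWord k deg)}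
    (h : ∀ w ∈ S, ofStd P (yAct P i (mono w)) = y P i * ofStd P (mono w)) {u : StdModule k deg}
    (hu : u ∈ Finsupp.supported (Poly k deg) (Poly k deg) S) :
    ofStd P (yAct P i u) = y P i * ofStd P u :=
  supported_induction (Q := fun u => ofStd P (yAct P i u) = y P i * ofStd P u) (by simp)
    (fun u v hu hv => by rw [map_add, map_add, map_add, hu, hv, mul_add])
    (fun f u hu => by
      rw [yAct_smul, map_add, ofStd_smul, ofStd_smul, ofStd_smul, hu, ← mul_assoc (y P i), y_mul_m,
        add_mul, mul_assoc]) h hu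

theorem ofStd_hamiltonian {u : StdModule k deg}
    (h : ∀ i, ofStd P (yAct P i u) = y P i * ofStd P u) (f : Poly k deg) :
    ofStd P (hamiltonian (act k deg) (yAct P) f u) = Env.h P f * ofStd P u := by
  rw [hamiltonian_act_apply, map_sum, h_eq_hamiltonian, hamiltonian_apply, Finset.sum_mul]
  exact Finset.sum_congr rfl fun r _ => by rw [ofStd_smul, h, mul_assoc]

/-- The rules defining `yAct` are relations of `R^e`, so the induction on length that built `yAct`
also shows that `ofStd` intertwines it with left multiplication by `y i`. -/
theorem ofStd_yAct_mono (i : Fin n) (w : StdWord k deg) :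
    ofStd P (yAct P i (mono w)) = y P i * ofStd P (mono w) := by
  induction hq : w.length using Nat.strong_induction_on generalizing i w with
  | _ q ih =>
    by_cases hi : CanCons i w
    · rw [yAct_mono_of_canCons hi, ofStd_mono, ofStd_mono, eval_cons]
    induction w using StdWord.cases_on with
    | nil => exact absurd (canCons_nil i) hi
    | cons j w hj =>
      rw [length_cons] at hq
      have hw (r : Fin n) : ofStd P (yAct P r (mono w)) = y P r * ofStd P (mono w) :=
        ih w.length (by omega) r w rfl
      rw [← yAct_mono_of_canCons hj, hw, yAct_mono_of_canCons hj]
      rcases lt_or_eq_of_not_canCons hi with hij | ⟨rfl, hi'⟩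
      · rw [yAct_mono_cons_of_lt hj hij, map_add, ofStd_smul_base, ofStd_hamiltonian hw,
          ← mul_assoc, y_mul_y, add_mul, smul_mul_assoc, mul_assoc, ← hw i]
        congr 2
        refine ofStd_yAct_of_mem ?_ (yAct_mono_mem i w)
        rintro v (hv | ⟨-, hv⟩)
        · exact ih v.length (by omega) j v rfl
        · rw [yAct_mono_of_canCons (hv j hij hj), ofStd_mono, ofStd_mono, eval_cons]
      · rw [yAct_mono_cons_self hj hi', ofStd_smul_base, ofStd_hamiltonian hw, ← mul_assoc,
          ← smul_mul_assoc]
        congr 1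
        have e := y_mul_y (P := P) i i
        rw [hi'.neg_one_zpow, neg_one_smul, ← sub_eq_iff_eq_add', sub_neg_eq_add,
          ← two_smul k] at e
        rw [← e, inv_smul_smul₀ hi'.2]

theorem ofStd_yAct (i : Fin n) (u : StdModule k deg) :
    ofStd P (yAct P i u) = y P i * ofStd P u :=
  ofStd_yAct_of_mem (S := Set.univ) (fun w _ => ofStd_yAct_mono i w) (by simp)

/-- The action of `F(R)` on the standard module. -/
def actFree (P : DGPoissonStructure (Poly.grading k deg)) :
    FreeExt k deg →ₐ[k] Module.End k (StdModule k deg) :=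
  FreeExt.lift (fun i => act k deg (Poly.x k deg i)) (yAct P) fun i j => by
    rw [← map_mul, ← map_mul, ← map_smul, Poly.x_comm i j]

theorem actFree_incl (f : Poly k deg) : actFree P (FreeExt.incl f) = act k deg f := by
  have e : (actFree P).comp FreeExt.incl = act k deg := by
    refine Poly.hom_ext (B := Module.End k (StdModule k deg)) fun i => ?_
    rw [AlgHom.comp_apply, FreeExt.incl, Poly.lift_x, actFree, FreeExt.lift_x]
  exact DFunLike.congr_fun e f

theorem actFree_y (i : Fin n) : actFree P (FreeExt.y k deg i) = yAct P i := by
  rw [actFree, FreeExt.lift_y]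

theorem actFree_x (i : Fin n) : actFree P (FreeExt.x k deg i) = act k deg (Poly.x k deg i) := by
  rw [actFree, FreeExt.lift_x]

theorem actFree_psi (f : Poly k deg) :
    actFree P (FreeExt.psi f) = hamiltonian (act k deg) (yAct P) f := by
  simp only [FreeExt.psi_apply, map_sum, map_mul, actFree_incl, actFree_y, hamiltonian_apply]

section Action

variable (h2 : (2 : k) = 0 → ∀ i, P.bracket (Poly.x k deg i) (Poly.x k deg i) = 0)
  (h3 : (3 : k) = 0 → ∀ i, Odd (deg i) → P.bracket (Poly.x k deg i)
    (P.bracket (Poly.x k deg i) (Poly.x k deg i)) = 0)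

/-- The action of `R^e` on the standard module. -/
def actEnv : Env P →ₐ[k] Module.End k (StdModule k deg) :=
  RingQuot.liftAlgHom k ⟨actFree P, by
    rintro _ _ (⟨i, j⟩ | ⟨i, j⟩)
    · rw [map_sub, map_sub, map_smul, map_mul, map_mul, map_zero, actFree_psi, actFree_y,
        actFree_y]
      refine LinearMap.ext fun u => ?_
      have e := isFlat h2 h3 u i j
      rw [curv_apply] at e
      exact e
    · rw [map_sub, map_sub, map_smul, map_mul, map_mul, map_zero, actFree_incl, actFree_y,
        actFree_x, isConnection_yAct i j]
      abel⟩

theorem actEnv_mk (z : FreeExt k deg) : actEnv h2 h3 (mk P z) = actFree P z :=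
  RingQuot.liftAlgHom_mkAlgHom_apply k _ _ _

theorem actEnv_m (f : Poly k deg) : actEnv h2 h3 (m P f) = act k deg f := by
  rw [m, AlgHom.comp_apply, actEnv_mk, actFree_incl]

theorem actEnv_y (i : Fin n) : actEnv h2 h3 (y P i) = yAct P i := by
  rw [y, actEnv_mk, actFree_y]

/-- Building up a standard word from the right, each letter can be prepended, so no rewriting
occurs. -/
theorem actEnv_eval (w : StdWord k deg) : actEnv h2 h3 (w.eval (y P)) (mono nil) = mono w := by
  obtain ⟨l, hl⟩ := w
  induction l with
  | nil => simp only [StdWord.eval, List.map_nil, List.prod_nil, map_one]; rfl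
  | cons i l ih =>
    have hl' := List.pairwise_cons.1 hl
    change actEnv h2 h3 (y P i * StdWord.eval (y P) ⟨l, hl'.2⟩) _ = _
    rw [map_mul, Module.End.mul_apply, ih hl'.2, actEnv_y,
      yAct_mono_of_canCons (w := ⟨l, hl'.2⟩) hl'.1]
    rfl

theorem actEnv_ofStd (u : StdModule k deg) : actEnv h2 h3 (ofStd P u) (mono nil) = u := by
  refine supported_induction (S := Set.univ)
    (Q := fun u => actEnv h2 h3 (ofStd P u) (mono nil) = u) ?_ ?_ ?_ ?_ (by simp)
  · simp
  · intro u v hu hv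
    rw [map_add, map_add, LinearMap.add_apply, hu, hv]
  · intro f u hu
    rw [ofStd_smul, map_mul, Module.End.mul_apply, hu, actEnv_m, act_apply]
  · intro w _
    rw [ofStd_mono, actEnv_eval]

/-- `ofStd` is linear over `R^e`. Hence acting on the empty word is also a right inverse of it,
which gives spanning. -/
theorem ofStd_actEnv (a : Env P) (u : StdModule k deg) :
    ofStd P (actEnv h2 h3 a u) = a * ofStd P u := by
  let φ : Env P →ₗ[k] Env P :=
    { toFun a := ofStd P (actEnv h2 h3 a u)
      map_add' a b := by rw [map_add, LinearMap.add_apply, map_add]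
      map_smul' c a := by
        rw [map_smul, LinearMap.smul_apply, ofStd_smul_base, RingHom.id_apply] }
  have e : φ = LinearMap.mulRight k (ofStd P u) := linearMap_ext fun p a ha => by
    change ofStd P (actEnv h2 h3 a u) = a * ofStd P u
    induction ha using homogeneous_induction with
    | one => simp
    | x_mul i p a ha ih =>
      rw [map_mul, Module.End.mul_apply, x, actEnv_m, act_apply, ofStd_smul, ih, mul_assoc]
    | y_mul i p a ha ih =>
      rw [map_mul, Module.End.mul_apply, actEnv_y, ofStd_yAct, ih, mul_assoc]
    | zero => simp
    | add p a b ha hb iha ihb => rw [map_add, LinearMap.add_apply, map_add, iha, ihb, add_mul]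
    | smul p c a ha ih =>
      rw [map_smul, LinearMap.smul_apply, ofStd_smul_base, ih, smul_mul_assoc]
  exact DFunLike.congr_fun e a

theorem ofStd_actEnv_nil (a : Env P) : ofStd P (actEnv h2 h3 a (mono nil)) = a := by
  rw [ofStd_actEnv, ofStd_mono, eval_nil, mul_one]

/-- The standard monomials form a basis of `R^e` as a left `R`-module. -/
theorem isBasis_left
    (h2 : (2 : k) = 0 → ∀ i, P.bracket (Poly.x k deg i) (Poly.x k deg i) = 0)
    (h3 : (3 : k) = 0 → ∀ i, Odd (deg i) → P.bracket (Poly.x k deg i)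
      (P.bracket (Poly.x k deg i) (Poly.x k deg i)) = 0) :
    IsBasis (Poly k deg) fun w : StdWord k deg => w.eval (y P) := by
  refine ⟨Function.LeftInverse.injective (g := fun a => actEnv h2 h3 a (mono nil))
    (actEnv_ofStd h2 h3), ?_⟩
  rw [← Finsupp.range_linearCombination, LinearMap.range_eq_top]
  exact Function.RightInverse.surjective (g := fun a => actEnv h2 h3 a (mono nil))
    (ofStd_actEnv_nil h2 h3)

/-- Moving `f` to the left past a letter twists it and leaves a bracket term with that letter
removed. So right multiples of monomials are triangular with respect to length, with bijective
twists as leading coefficients. -/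
theorem actEnv_eval_smul_sub_mem (w : StdWord k deg) (f : Poly k deg) :
    actEnv h2 h3 (w.eval (y P)) (f • mono nil) - Poly.twistWord w.1 f • mono w ∈
      Finsupp.supported (Poly k deg) (Poly k deg) {v | v.length < w.length} := by
  obtain ⟨l, hl⟩ := w
  induction l with
  | nil =>
    simp only [StdWord.eval, List.map_nil, List.prod_nil, map_one, Module.End.one_apply,
      Poly.twistWord, AlgHom.id_apply]
    rw [show (⟨[], hl⟩ : StdWord k deg) = nil from rfl, sub_self]
    exact Submodule.zero_mem _
  | cons i l ih =>
    have hl' := List.pairwise_cons.1 hl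
    have ih' := yAct_mem_of_length (i := i) (P := P) (ih hl'.2)
    change actEnv h2 h3 (y P i * StdWord.eval (y P) ⟨l, hl'.2⟩) _ -
      Poly.twist i (Poly.twistWord l f) • mono (cons i ⟨l, hl'.2⟩ hl'.1) ∈ _
    rw [map_mul, Module.End.mul_apply, actEnv_y]
    rw [map_sub, yAct_smul, yAct_mono_of_canCons (w := ⟨l, hl'.2⟩) hl'.1, ← sub_sub] at ih'
    rw [← sub_add_cancel (_ - _ : StdModule k deg)
      (P.bracket (Poly.x k deg i) (Poly.twistWord l f) • mono (⟨l, hl'.2⟩ : StdWord k deg))]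
    refine Submodule.add_mem _ ih' (Submodule.smul_mem _ _ (mono_mem ?_))
    exact Nat.lt_succ_self _

/-- The standard monomials form a basis of `R^e` as a right `R`-module. -/
theorem isBasis_right
    (h2 : (2 : k) = 0 → ∀ i, P.bracket (Poly.x k deg i) (Poly.x k deg i) = 0)
    (h3 : (3 : k) = 0 → ∀ i, Odd (deg i) → P.bracket (Poly.x k deg i)
      (P.bracket (Poly.x k deg i) (Poly.x k deg i)) = 0) :
    IsBasis (Poly k deg)ᵐᵒᵖ fun w : StdWord k deg => w.eval (y P) := by
  constructor
  · rw [linearIndependent_iff]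
    intro c hc
    by_contra hne
    -- At a word of maximal length in the support only its own term contributes, with coefficient
    -- `twistWord` of `c w`, and the twist is injective.
    obtain ⟨w, hw, hmax⟩ := c.support.exists_max_image StdWord.length
      (Finsupp.support_nonempty_iff.2 hne)
    have key : ∀ v ∈ c.support, v ≠ w →
        (actEnv h2 h3 (c v • v.eval (y P)) (mono nil)) w = 0 := by
      intro v hv hvw
      obtain ⟨f, hf⟩ := MulOpposite.op_surjective (c v)
      rw [← hf, op_smul_def, map_mul, Module.End.mul_apply, actEnv_m, act_apply]
      have h := actEnv_eval_smul_sub_mem h2 h3 v f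
      rw [Finsupp.mem_supported'] at h
      have h' := h w (by simpa using hmax v hv)
      rw [Finsupp.sub_apply, Finsupp.smul_apply, mono_apply_of_ne hvw, smul_zero, sub_zero] at h'
      exact h'
    have e := congrArg (fun a => (actEnv h2 h3 a (mono nil)) w) hc
    simp only [Finsupp.linearCombination_apply, Finsupp.sum, map_sum, LinearMap.sum_apply,
      Finsupp.finsetSum_apply, map_zero, LinearMap.zero_apply, Finsupp.zero_apply] at e
    rw [Finset.sum_eq_single_of_mem w hw key] at e
    obtain ⟨f, hf⟩ := MulOpposite.op_surjective (c w)
    rw [← hf, op_smul_def, map_mul, Module.End.mul_apply, actEnv_m, act_apply] at e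
    have h := actEnv_eval_smul_sub_mem h2 h3 w f
    rw [Finsupp.mem_supported'] at h
    have h' := h w (by simp)
    rw [Finsupp.sub_apply, e, Finsupp.smul_apply, mono_apply_self, smul_eq_mul, mul_one,
      zero_sub, neg_eq_zero, map_eq_zero_iff _ (Poly.twistWord_bijective w.1).injective] at h'
    rw [Finsupp.mem_support_iff, ← hf, h'] at hw
    exact hw rfl
  · set N := Submodule.span (Poly k deg)ᵐᵒᵖ (Set.range fun w : StdWord k deg => w.eval (y P))
    have sum_mem (u : StdModule k deg)
        (h : ∀ w ∈ u.support, ofStd P (Finsupp.single w (u w)) ∈ N) : ofStd P u ∈ N := by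
      rw [← Finsupp.sum_single u, Finsupp.sum, map_sum]
      exact Submodule.sum_mem _ h
    have key (w : StdWord k deg) (f : Poly k deg) : ofStd P (Finsupp.single w f) ∈ N := by
      induction hq : w.length using Nat.strong_induction_on generalizing w f with
      | _ q ih =>
        -- The twist is surjective, so `f` is the leading coefficient of some right multiple of the
        -- monomial; the difference consists of shorter words.
        obtain ⟨g, rfl⟩ := (Poly.twistWord_bijective w.1).surjective f
        have h := actEnv_eval_smul_sub_mem h2 h3 w g
        have e : Finsupp.single w (Poly.twistWord w.1 g) =
            actEnv h2 h3 (w.eval (y P)) (g • mono nil) -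
            (actEnv h2 h3 (w.eval (y P)) (g • mono nil) - Poly.twistWord w.1 g • mono w) := by
          rw [sub_sub_cancel, mono, Finsupp.smul_single, smul_eq_mul, mul_one]
        rw [e, map_sub]
        refine Submodule.sub_mem _ ?_ (sum_mem _ fun v hv => ih v.length ?_ v _ rfl)
        · rw [ofStd_actEnv, ofStd_smul, ofStd_mono, eval_nil, mul_one, ← op_smul_def]
          exact Submodule.smul_mem _ _ (Submodule.subset_span ⟨w, rfl⟩)
        · rw [← hq]
          exact (Finsupp.mem_supported _ _).1 h hv
    rw [eq_top_iff]
    intro a _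
    rw [← ofStd_actEnv_nil h2 h3 a]
    exact sum_mem _ fun w _ => key w _

end Action

end Env

end Basis

/-! ### Transport of bases -/

section IsBasis

variable {S : Type*} [Ring S] {M : Type*} [AddCommGroup M] [Module S M] {ι κ : Type*}

theorem IsBasis.comp_bijective {v : ι → M} (hv : IsBasis S v) {e : κ → ι}
    (he : Function.Bijective e) : IsBasis S fun i => v (e i) := by
  refine ⟨hv.1.comp e he.injective, ?_⟩
  rw [← hv.2]
  congr 1
  exact he.surjective.range_comp v

theorem IsBasis.map_linearEquiv {N : Type*} [AddCommGroup N] [Module S N] {v : ι → M}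
    (hv : IsBasis S v) (e : M ≃ₗ[S] N) : IsBasis S fun i => e (v i) := by
  refine ⟨hv.1.map' e.toLinearMap e.ker, ?_⟩
  have h : Set.range (fun i => e (v i)) = e.toLinearMap '' Set.range v := Set.range_comp e v
  rw [h, Submodule.span_image, hv.2, Submodule.map_top, LinearEquiv.range]

/-- Bases in a tower of rings. -/
theorem IsBasis.smul {k : Type*} [Ring k] [Module k S] [Module k M] [IsScalarTower k S M]
    {b : ι → S} {c : κ → M} (hb : IsBasis k b) (hc : IsBasis S c) :
    IsBasis k fun p : ι × κ => b p.1 • c p.2 := by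
  refine ⟨linearIndependent_smul hb.1 hc.1, ?_⟩
  have h := Submodule.span_smul_of_span_eq_top hb.2 (Set.range c)
  rw [hc.2, Submodule.restrictScalars_top] at h
  rw [← h]
  congr 1
  ext a
  simp [Set.mem_smul]

end IsBasis

/-! ### Exponents correspond to standard words -/

section Exponents

variable {k : Type*} [Field k] {n : ℕ} {deg : Fin n → ℤ}

/-- The list with `J r` entries `r`, in increasing order. -/
def exponentList (J : Fin n → ℕ) : List (Fin n) :=
  (List.ofFn fun r => List.replicate (J r) r).flatten

theorem orderedMonomial_eq {A : Type*} [Ring A] (g : Fin n → A) (J : Fin n → ℕ) :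
    orderedMonomial g J = ((exponentList J).map g).prod := by
  simp [orderedMonomial, exponentList, List.prod_flatten, List.map_flatten, List.map_ofFn,
    Function.comp_def]

theorem count_exponentList (J : Fin n → ℕ) (r : Fin n) : (exponentList J).count r = J r := by
  simp [exponentList, List.count_flatten, List.map_ofFn, Function.comp_def, List.sum_ofFn,
    List.count_replicate]

/-- The standard word of an exponent. -/
def Exponent.toWord (J : Exponent k deg) : StdWord k deg :=
  ⟨exponentList J.1, by
    rw [exponentList, List.pairwise_flatten, List.pairwise_ofFn]
    refine ⟨fun l hl => ?_, fun i j hij a ha b hb => ?_⟩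
    · obtain ⟨r, rfl⟩ := List.mem_ofFn.1 hl
      rw [List.pairwise_replicate]
      by_cases hr : IsFermionic k deg r
      · exact Or.inl (J.2 r hr.1 hr.2)
      · exact Or.inr (Or.inr ⟨rfl, hr⟩)
    · rw [List.eq_of_mem_replicate ha, List.eq_of_mem_replicate hb]
      exact Or.inl hij⟩

/-- A standard word is sorted, hence determined by its multiplicities. -/
theorem Exponent.toWord_bijective : Function.Bijective (toWord (k := k) (deg := deg)) := by
  constructor
  · intro J J' h
    refine Subtype.ext (funext fun r => ?_)
    rw [← count_exponentList J.1, ← count_exponentList J'.1]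
    exact congrArg (fun w : StdWord k deg => w.1.count r) h
  · intro w
    let J : Exponent k deg := ⟨fun r => w.1.count r, fun r hr hk => by
      by_contra h
      -- A multiplicity of at least 2 makes `[r, r]` a sublist, which is not standard for fermionic
      -- `r`.
      have h' : [r, r].Pairwise (Precedes k deg) :=
        w.2.sublist (List.replicate_sublist_iff.2 (Nat.succ_le_of_lt (not_le.1 h)))
      rcases List.rel_of_pairwise_cons h' (List.mem_singleton_self r) with h | ⟨-, h⟩
      · exact lt_irrefl _ h
      · exact h ⟨hr, hk⟩⟩
    refine ⟨J, Subtype.ext (List.Perm.eq_of_pairwise' (r := (· ≤ ·))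
      (J.toWord.2.imp Precedes.le) (w.2.imp Precedes.le) (List.perm_iff_count.2 fun r => ?_))⟩
    exact count_exponentList _ r

theorem orderedMonomial_eq_eval {A : Type*} [Ring A] (g : Fin n → A) (J : Exponent k deg) :
    orderedMonomial g J.1 = J.toWord.eval g := orderedMonomial_eq g J.1

theorem orderedMonomial_mem {A : Type*} [Ring A] [Algebra k A] {𝒜 : ℤ → Submodule k A}
    [SetLike.GradedMonoid 𝒜] {g : Fin n → A} {w : Fin n → ℤ} (hg : ∀ r, g r ∈ 𝒜 (w r))
    (J : Fin n → ℕ) : orderedMonomial g J ∈ 𝒜 (∑ r, (J r : ℤ) * w r) := by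
  rw [← List.sum_ofFn]
  refine SetLike.list_prod_ofFn_mem_graded _ _ fun r => ?_
  simpa using SetLike.pow_mem_graded (J r) (hg r)

theorem map_orderedMonomial {A B F : Type*} [Ring A] [Ring B] [FunLike F A B]
    [MonoidHomClass F A B] (φ : F) (g : Fin n → A) (J : Fin n → ℕ) :
    φ (orderedMonomial g J) = orderedMonomial (fun r => φ (g r)) J := by
  simp [orderedMonomial, map_list_prod, List.map_ofFn, Function.comp_def]

end Exponents

/-! ### A `k`-basis of `R`, from the zero bracket -/

section PolyBasis

variable (k : Type*) [Field k] {n : ℕ} (deg : Fin n → ℤ)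

/-- The zero bracket and the zero differential. -/
def DGPoissonStructure.zeroBracket : DGPoissonStructure (Poly.grading k deg) where
  bracket := 0
  d := 0
  isDGAlgebra := ⟨by simp, by simp, by simp⟩
  mul_comm _ _ _ ha _ hb := Poly.graded_comm ha hb
  bracket_mem := by simp
  antisymm := by simp
  jacobi := by simp
  bracket_mul := by simp
  d_bracket := by simp

/-- The augmentation `R → k`. -/
def Poly.augmentation : Poly k deg →ₐ[k] k := Poly.lift 0 (by simp)

instance : Nontrivial (Poly k deg) := (Poly.augmentation k deg).toRingHom.domain_nontrivial

theorem DGPoissonStructure.zeroBracket_bracket (a b : Poly k deg) :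
    (zeroBracket k deg).bracket a b = 0 := rfl

open DGPoissonStructure in
/-- The map `R → R^e`, `x_i ↦ y_i`, for the zeroBracket Poisson structure. -/
def Env.ofPolyZeroBracket : Poly k deg →ₐ[k] Env (zeroBracket k deg) :=
  Poly.lift (Env.y _) fun i j => by
    rw [Env.y_mul_y i j, zeroBracket_bracket, map_zero, add_zero]

open DGPoissonStructure in
/-- The map `R^e → R`, `x_i ↦ 0`, `y_i ↦ x_i`, for the zeroBracket Poisson structure. -/
def Env.toPolyZeroBracket : Env (zeroBracket k deg) →ₐ[k] Poly k deg :=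
  RingQuot.liftAlgHom k ⟨FreeExt.lift 0 (Poly.x k deg) (by simp), by
    rintro _ _ (⟨i, j⟩ | ⟨i, j⟩)
    · simp [zeroBracket_bracket, Poly.x_comm i j]
    · simp [zeroBracket_bracket]⟩

open DGPoissonStructure in
theorem Env.toPolyZeroBracket_y (i : Fin n) :
    Env.toPolyZeroBracket k deg (Env.y (zeroBracket k deg) i) = Poly.x k deg i :=
  (RingQuot.liftAlgHom_mkAlgHom_apply k _ _ _).trans (FreeExt.lift_y _ _ _ i)

open DGPoissonStructure in
theorem Env.toPolyZeroBracket_m (f : Poly k deg) :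
    Env.toPolyZeroBracket k deg (Env.m (zeroBracket k deg) f) =
      algebraMap k (Poly k deg) (Poly.augmentation k deg f) := by
  have e : (Env.toPolyZeroBracket k deg).comp (Env.m (zeroBracket k deg)) =
      (Algebra.ofId k (Poly k deg)).comp (Poly.augmentation k deg) := by
    refine Poly.hom_ext fun i => ?_
    change Env.toPolyZeroBracket k deg (Env.x _ i) = _
    rw [← Env.mk_x, Env.toPolyZeroBracket]
    refine (RingQuot.liftAlgHom_mkAlgHom_apply k _ _ _).trans ((FreeExt.lift_x _ _ _ i).trans ?_)
    simp [Poly.augmentation]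
  exact DFunLike.congr_fun e f

open DGPoissonStructure in
/-- The ordered monomials form a basis of `R`. -/
theorem Poly.isBasis :
    IsBasis k fun I : Exponent k deg => orderedMonomial (Poly.x k deg) I.1 := by
  -- There is no circularity: the left basis theorem does not use any basis of `R`.
  have hB : IsBasis (Poly k deg) fun J : Exponent k deg =>
      orderedMonomial (Env.y (zeroBracket k deg)) J.1 := by
    simp only [orderedMonomial_eq_eval]
    exact (Env.isBasis_left (P := zeroBracket k deg) (fun _ _ => rfl)
      (fun _ _ _ => rfl)).comp_bijective Exponent.toWord_bijective
  constructor
  · refine LinearIndependent.of_comp (Env.ofPolyZeroBracket k deg).toLinearMap ?_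
    have e : (Env.ofPolyZeroBracket k deg).toLinearMap ∘
        (fun I : Exponent k deg => orderedMonomial (Poly.x k deg) I.1) =
        fun J => orderedMonomial (Env.y (zeroBracket k deg)) J.1 := by
      funext J
      simp [map_orderedMonomial, Env.ofPolyZeroBracket]
    rw [e]
    exact hB.1.restrict_scalars' k
  · rw [eq_top_iff]
    intro f _
    set N := Submodule.span k
      (Set.range fun I : Exponent k deg => orderedMonomial (Poly.x k deg) I.1)
    -- Under `x_i ↦ 0`, `y_i ↦ x_i` the coefficients in `R` become scalars, so `R`-combinations of
    -- the `y^J` go to `k`-combinations of the `x^J`. As the composite with `x_i ↦ y_i` is the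
    -- identity of `R`, this covers every `f`.
    have key : ∀ a ∈ Submodule.span (Poly k deg) (Set.range fun J : Exponent k deg =>
        orderedMonomial (Env.y (zeroBracket k deg)) J.1), Env.toPolyZeroBracket k deg a ∈ N := by
      intro a ha
      induction ha using Submodule.span_induction with
      | mem a h =>
        obtain ⟨J, rfl⟩ := h
        simp only [map_orderedMonomial, Env.toPolyZeroBracket_y]
        exact Submodule.subset_span ⟨J, rfl⟩
      | zero => rw [map_zero]; exact Submodule.zero_mem _
      | add a b _ _ ha hb => rw [map_add]; exact Submodule.add_mem _ ha hb
      | smul f a _ ha =>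
        rw [Env.smul_def, map_mul, Env.toPolyZeroBracket_m, ← Algebra.smul_def]
        exact Submodule.smul_mem _ _ ha
    have e : (Env.toPolyZeroBracket k deg).comp (Env.ofPolyZeroBracket k deg) =
        AlgHom.id k (Poly k deg) := Poly.hom_ext fun i => by
      simp [Env.ofPolyZeroBracket, Env.toPolyZeroBracket_y]
    have h := key (Env.ofPolyZeroBracket k deg f) (by rw [hB.2]; exact Submodule.mem_top)
    rwa [← AlgHom.comp_apply, e] at h

end PolyBasis

end DGPoisson

/-! ### The theorem -/

theorem mainTheorem3 {k : Type*} [Field k] {n : ℕ} (deg : Fin n → ℤ)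
    (P : DGPoisson.DGPoissonStructure (DGPoisson.Poly.grading k deg))
    (h2 : (2 : k) = 0 → ∀ i,
      P.bracket (DGPoisson.Poly.x k deg i) (DGPoisson.Poly.x k deg i) = 0)
    (h3 : (3 : k) = 0 → ∀ i, Odd (deg i) →
      P.bracket (DGPoisson.Poly.x k deg i)
        (P.bracket (DGPoisson.Poly.x k deg i) (DGPoisson.Poly.x k deg i)) = 0) :
    ∃ δ : DGPoisson.Env P →ₗ[k] DGPoisson.Env P,
      -- `R^e` is a DG algebra, with the differential extending that of `R`
      DGPoisson.IsDGAlgebra (DGPoisson.Env.grading P) δ ∧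
      (∀ f, δ (DGPoisson.Env.m P f) = DGPoisson.Env.m P (P.d f)) ∧
      (∀ f, δ (DGPoisson.Env.h P f) = DGPoisson.Env.h P (P.d f)) ∧
      -- hence a left and a right DG module over `R`
      DGPoisson.IsLeftDGModule (DGPoisson.Poly.grading k deg) P.d (DGPoisson.Env.grading P) δ ∧
      DGPoisson.IsRightDGModule (DGPoisson.Poly.grading k deg) P.d (DGPoisson.Env.grading P) δ ∧
      -- the monomials in the `y_r` are homogeneous
      (∀ J : DGPoisson.Exponent k deg, DGPoisson.orderedMonomial (DGPoisson.Env.y P) J.1 ∈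
        DGPoisson.Env.grading P (∑ r, (J.1 r : ℤ) * deg r)) ∧
      -- and form a basis of `R^e` as a left and as a right `R`-module
      DGPoisson.IsBasis (DGPoisson.Poly k deg)
        (fun J : DGPoisson.Exponent k deg =>
          DGPoisson.orderedMonomial (DGPoisson.Env.y P) J.1) ∧
      DGPoisson.IsBasis (DGPoisson.Poly k deg)ᵐᵒᵖ
        (fun J : DGPoisson.Exponent k deg =>
          DGPoisson.orderedMonomial (DGPoisson.Env.y P) J.1) ∧
      -- the monomials `x^I y^J`, and the reversed monomials `y^J x^I`, are `k`-bases of `R^e`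
      DGPoisson.IsBasis k
        (fun IJ : DGPoisson.Exponent k deg × DGPoisson.Exponent k deg =>
          DGPoisson.orderedMonomial (DGPoisson.Env.x P) IJ.1.1 *
            DGPoisson.orderedMonomial (DGPoisson.Env.y P) IJ.2.1) ∧
      DGPoisson.IsBasis k
        (fun JI : DGPoisson.Exponent k deg × DGPoisson.Exponent k deg =>
          DGPoisson.orderedMonomial (DGPoisson.Env.y P) JI.1.1 *
            DGPoisson.orderedMonomial (DGPoisson.Env.x P) JI.2.1) := by

  have hleft : DGPoisson.IsBasis (DGPoisson.Poly k deg) fun J : DGPoisson.Exponent k deg =>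
      DGPoisson.orderedMonomial (DGPoisson.Env.y P) J.1 := by
    simp only [DGPoisson.orderedMonomial_eq_eval]
    exact (DGPoisson.Env.isBasis_left h2 h3).comp_bijective DGPoisson.Exponent.toWord_bijective
  have hright : DGPoisson.IsBasis (DGPoisson.Poly k deg)ᵐᵒᵖ fun J : DGPoisson.Exponent k deg =>
      DGPoisson.orderedMonomial (DGPoisson.Env.y P) J.1 := by
    simp only [DGPoisson.orderedMonomial_eq_eval]
    exact (DGPoisson.Env.isBasis_right h2 h3).comp_bijective DGPoisson.Exponent.toWord_bijective
  have hx (I : DGPoisson.Exponent k deg) : DGPoisson.orderedMonomial (DGPoisson.Env.x P) I.1 =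
      DGPoisson.Env.m P (DGPoisson.orderedMonomial (DGPoisson.Poly.x k deg) I.1) :=
    (DGPoisson.map_orderedMonomial (DGPoisson.Env.m P) _ _).symm
  refine ⟨DGPoisson.Env.diff P, DGPoisson.Env.isDGAlgebra P, DGPoisson.Env.diff_m P,
    DGPoisson.Env.diff_h P, DGPoisson.Env.isLeftDGModule P, DGPoisson.Env.isRightDGModule P,
    fun J => DGPoisson.orderedMonomial_mem DGPoisson.Env.y_mem J.1, hleft, hright, ?_, ?_⟩
  · have hb := (DGPoisson.Poly.isBasis k deg).smul hleft
    simp only [DGPoisson.Env.smul_def, ← hx] at hb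
    exact hb
  · have hop : DGPoisson.IsBasis k fun I : DGPoisson.Exponent k deg =>
        MulOpposite.op (DGPoisson.orderedMonomial (DGPoisson.Poly.x k deg) I.1) :=
      (DGPoisson.Poly.isBasis k deg).map_linearEquiv (MulOpposite.opLinearEquiv k)
    -- The tower yields pairs with the `x`-exponent first, whereas the reversed monomials list the
    -- `y`-exponent first; hence the swap.
    have hb := (hop.smul hright).comp_bijective Prod.swap_bijective
    simp only [DGPoisson.Env.op_smul_def, ← hx] at hb
    exact hb
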